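/- Let $(\mathcal Y,dy)$ be a measurable space with a $\sigma$-finite measure and let $P_0$ be a probability density with respect to $dy$. Let $g_1,\dots,g_k:\mathcal Y\to\mathbb R$ be measurable, let $\Theta\subset\mathbb R^k$ be measurable, and let $\phi$ be a $C^2$ function on $\Theta$ such that $$e^{\phi(\theta)}=\int_{\mathcal Y}P_0(y)\,e^{\sum_{j=1}^k\theta^jg_j(y)}\,dy<\infty\qquad(\theta\in\Theta).$$ Consider the exponential family $P_\theta(y)=P_0(y)\,e^{\sum_{j=1}^k\theta^jg_j(y)-\phi(\theta)}$, $\theta\in\Theta$, and its Fisher information matrix $J_\theta=\big(\partial^2\phi(\theta)/\partial\theta^i\partial\theta^j\big)_{i,j}$. Let $w$ be the density, with respect to Lebesgue measure, of a probability distribution on $\Theta$, and assume that $w$ is continuous on $\Theta$. Put $P_\theta^n(y^n)=\prod_{i=1}^nP_\theta(y_i)$ and $Q_w^n(y^n)=\int_\Theta P_\theta^n(y^n)\,w(\theta)\,d\theta$, and for $s>0$ let $D_{1+s}(P\|Q)=\frac1s\log E_P\big[(P/Q)^s\big]$ (natural logarithm) be the Rényi divergence of order $1+s$. Then the following hold.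 1. For every $\theta$ in the interior of $\Theta$ with $w(\theta)>0$, $$D_{1+n}(P_\theta^n\|Q_w^n)\le\frac k2\log n+O(1)\qquad(n\to\infty).$$ 2. The bound in 1 is uniform on compact sets: if $K$ is a compact subset of the interior of $\Theta$ and $w>0$ on $K$, then there are constants $C$ and $N$ such that $D_{1+n}(P_\theta^n\|Q_w^n)\le\frac k2\log n+C$ for all $n\ge N$ and all $\theta\in K$. 3. For every fixed $s>0$ and every $\theta$ in the interior of $\Theta$ with $w(\theta)>0$ and $\det J_\theta\ne0$, $$D_{1+s}(P_\theta^n\|Q_w^n)\le\frac k2\log\frac n{2\pi}+\frac12\log\det J_\theta+\log\frac1{w(\theta)}-\frac k{2s}\log(1+s)+o(1)\qquad(n\to\infty).$$ -/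

import Mathlib

open MeasureTheory Filter Topology
open scoped ENNReal NNReal

noncomputable section

/-- The Rényi divergence `D_α(P‖Q) = (α - 1)⁻¹ log E_P[(P / Q)^(α - 1)]`, natural logarithm, of two
distributions given by their densities `p`, `q` with respect to a common measure `μ`. It is
extended-real valued (it is `⊤` if, for `α > 1`, the expectation is infinite, in particular
if `P` is not absolutely continuous with respect to `Q`). -/
def renyiDiv {Z : Type*} [MeasurableSpace Z] (μ : Measure Z) (α : ℝ) (p q : Z → ℝ≥0∞) : EReal :=
  (((α - 1)⁻¹ : ℝ) : EReal) * ENNReal.log (∫⁻ z, p z * (p z / q z) ^ (α - 1) ∂μ)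

/-- `P_θ(y) = P₀(y) exp(∑ j, θ^j g_j(y) - φ(θ))`, a density with respect to the
dominating measure. -/
def expDensity {k : ℕ} {Y : Type*} (p₀ : Y → ℝ≥0) (g : Fin k → Y → ℝ)
    (φ : EuclideanSpace ℝ (Fin k) → ℝ) (θ : EuclideanSpace ℝ (Fin k)) (y : Y) : ℝ≥0∞ :=
  (p₀ y : ℝ≥0∞) * ENNReal.ofReal (Real.exp (∑ j, θ j * g j y - φ θ))

/-- The data `p₀` (density of the base distribution with respect to `μ`), `g` (generators),
`φ` (potential) and `Θ` (parameter set) form an exponential family `θ ↦ expDensity p₀ g φ θ`. -/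
structure IsExponentialFamily {k : ℕ} {Y : Type*} [MeasurableSpace Y] (μ : Measure Y)
    (p₀ : Y → ℝ≥0) (g : Fin k → Y → ℝ) (φ : EuclideanSpace ℝ (Fin k) → ℝ)
    (Θ : Set (EuclideanSpace ℝ (Fin k))) : Prop where
  measurable_base : Measurable p₀
  lintegral_base : ∫⁻ y, (p₀ y : ℝ≥0∞) ∂μ = 1
  measurable_generator : ∀ j, Measurable (g j)
  measurableSet_param : MeasurableSet Θ
  /-- `exp φ(θ) = ∫ P₀(y) exp(∑ j, θ^j g_j(y)) dy < ∞` on `Θ`. -/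
  exp_potential : ∀ θ ∈ Θ,
    ∫⁻ y, (p₀ y : ℝ≥0∞) * ENNReal.ofReal (Real.exp (∑ j, θ j * g j y)) ∂μ
      = ENNReal.ofReal (Real.exp (φ θ))
  contDiffOn_potential : ContDiffOn ℝ 2 φ Θ

/-- `w` is the Lebesgue density of a probability distribution on `Θ`. -/
structure IsPriorDensity {k : ℕ} (Θ : Set (EuclideanSpace ℝ (Fin k)))
    (w : EuclideanSpace ℝ (Fin k) → ℝ) : Prop where
  nonneg : ∀ θ ∈ Θ, 0 ≤ w θ
  lintegral_eq_one : ∫⁻ θ in Θ, ENNReal.ofReal (w θ) = 1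

/-- The density `P^n(y₁, …, y_n) = P(y₁) ⋯ P(y_n)` with respect to the product measure. -/
def iidDensity {Y : Type*} (p : Y → ℝ≥0∞) (n : ℕ) (y : Fin n → Y) : ℝ≥0∞ :=
  ∏ i, p (y i)

/-- The density of the Bayesian mixture `Q_w^n(y^n) = ∫_Θ P_θ^n(y^n) w(θ) dθ` of the family of
densities `p` with prior density `w` on `Θ`. -/
def mixtureDensity {k : ℕ} {Y : Type*} (Θ : Set (EuclideanSpace ℝ (Fin k)))
    (w : EuclideanSpace ℝ (Fin k) → ℝ) (p : EuclideanSpace ℝ (Fin k) → Y → ℝ≥0∞)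
    (n : ℕ) (y : Fin n → Y) : ℝ≥0∞ :=
  ∫⁻ θ in Θ, iidDensity (p θ) n y * ENNReal.ofReal (w θ)

/-- The Fisher information matrix of an exponential family at an interior point of the parameter
set: the Hessian `J_θ = (∂²φ(θ) / ∂θ^i ∂θ^j)` of the potential, which is
`- ∂² log P_θ(y) / ∂θ^i ∂θ^j` for every `y`. -/
def fisherInfo {k : ℕ} (φ : EuclideanSpace ℝ (Fin k) → ℝ) (θ : EuclideanSpace ℝ (Fin k)) :
    Matrix (Fin k) (Fin k) ℝ :=
  Matrix.of fun i j =>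
    fderiv ℝ (fun η => fderiv ℝ φ η (EuclideanSpace.single j 1)) θ (EuclideanSpace.single i 1)

/-- `D_{1+s}(P_θ^n ‖ Q_w^n)` for the exponential family given by `p₀`, `g`, `φ`, `Θ` and the prior
density `w`. -/
def renyiRedundancy {k : ℕ} {Y : Type*} [MeasurableSpace Y] (μ : Measure Y)
    (p₀ : Y → ℝ≥0) (g : Fin k → Y → ℝ) (φ : EuclideanSpace ℝ (Fin k) → ℝ)
    (Θ : Set (EuclideanSpace ℝ (Fin k))) (w : EuclideanSpace ℝ (Fin k) → ℝ)
    (s : ℝ) (n : ℕ) (θ : EuclideanSpace ℝ (Fin k)) : EReal :=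
  renyiDiv (Measure.pi fun _ : Fin n => μ) (1 + s)
    (iidDensity (expDensity p₀ g φ θ) n) (mixtureDensity Θ w (expDensity p₀ g φ) n)

end

/-! This is Laplace's method, used only to bound the mixture from below. Restrict the integral
defining `Q_w^n` to `η = θ + u/√n` with `‖u‖ ≤ M`. Within an exponential family the log-likelihood
ratio of `η` to `θ` is exactly linear in the data minus `n (φ(η) - φ(θ))`, so an upper Taylor bound
on `φ` gives `Q_w^n ≥ P_θ^n · n^{-k/2} w₁ e^{-ε} W_M(S_n)`. Here `S_n` is the normalized score, `w₁`
bounds `w` from below near `θ`, and `W_M` is the truncated Gaussian integral `gaussWindow`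
(`mul_gaussWindow_le_mixtureDensity`). Hence the divergence is at most `(k/2) log n - log w₁ + ε +
s⁻¹ log E[W_M(S_n)^{-s}]` (`renyiRedundancy_le`).

For orders growing with `n`, no probability is needed: by symmetry of the ball `W_M ≥ W_M(0) > 0`
(`gaussWindow_zero_le`), so the last term is at most `-log W_M(0)`, whatever `s`, `n` and the data
are. Compactness makes the remaining constants uniform.

For fixed `s`, the function `W_M^{-s}` is bounded and continuous. The central limit theorem
(`tendsto_integral_score`) replaces `S_n` by `A ξ`, with `ξ` standard Gaussian and `A` the symmetric
square root of the Hessian. Letting `M → ∞` gives `W_M(A ξ) → |det A|⁻¹ (2π)^{k/2} exp(‖ξ‖²/2)`, and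
`E exp(-s‖ξ‖²/2) = (1+s)^{-k/2}` supplies the final constant (`tendsto_integral_gaussWindow_rpow`).
-/

/-- A one-dimensional second order Taylor bound. -/
theorem taylor_le_of_second_deriv_le {f f' f'' : ℝ → ℝ} {A : ℝ}
    (hf : ∀ t ∈ Set.Icc (0 : ℝ) 1, HasDerivAt f (f' t) t)
    (hf' : ∀ t ∈ Set.Icc (0 : ℝ) 1, HasDerivAt f' (f'' t) t)
    (hA : ∀ t ∈ Set.Icc (0 : ℝ) 1, f'' t ≤ A) :
    f 1 ≤ f 0 + f' 0 + A / 2 := by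
  -- Integrate twice: `f'' ≤ A` makes `f' - A t` decrease, so `f - f'(0) t - A t²/2` has nonpositive
  -- derivative.
  have h1 : AntitoneOn (fun t => f' t - A * t) (Set.Icc 0 1) := by
    have hd : ∀ t ∈ Set.Icc (0 : ℝ) 1, HasDerivAt (fun t => f' t - A * t) (f'' t - A) t := by
      intro t ht
      have := (hf' t ht).sub ((hasDerivAt_id t).const_mul A)
      convert! this using 1
      simp
    refine antitoneOn_of_deriv_nonpos (convex_Icc 0 1)
      (fun t ht => (hd t ht).continuousAt.continuousWithinAt)
      (fun t ht => (hd t (interior_subset ht)).differentiableAt.differentiableWithinAt) ?_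
    intro t ht
    rw [(hd t (interior_subset ht)).deriv]
    linarith [hA t (interior_subset ht)]
  have h2 : AntitoneOn (fun t => f t - f' 0 * t - A * t ^ 2 / 2) (Set.Icc 0 1) := by
    have hd : ∀ t ∈ Set.Icc (0 : ℝ) 1,
        HasDerivAt (fun t => f t - f' 0 * t - A * t ^ 2 / 2) (f' t - f' 0 - A * t) t := by
      intro t ht
      have := ((hf t ht).sub ((hasDerivAt_id t).const_mul (f' 0))).sub
        (((hasDerivAt_pow 2 t).const_mul A).div_const 2)
      convert! this using 1
      simp
      ring
    refine antitoneOn_of_deriv_nonpos (convex_Icc 0 1)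
      (fun t ht => (hd t ht).continuousAt.continuousWithinAt)
      (fun t ht => (hd t (interior_subset ht)).differentiableAt.differentiableWithinAt) ?_
    intro t ht
    rw [(hd t (interior_subset ht)).deriv]
    have := h1 (Set.left_mem_Icc.2 zero_le_one) (interior_subset ht) (interior_subset ht).1
    simp only [mul_zero, sub_zero] at this
    linarith
  have := h2 (Set.left_mem_Icc.2 zero_le_one) (Set.right_mem_Icc.2 zero_le_one) zero_le_one
  norm_num at this
  linarith

/-! ### Second order upper bounds for `C²` functions. -/

section Taylor

variable {E : Type*} [NormedAddCommGroup E] [NormedSpace ℝ E] {φ : E → ℝ} {U : Set E}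

theorem hasDerivAt_comp_line (hU : IsOpen U) (hφ : ContDiffOn ℝ 2 φ U) {θ h : E} {t : ℝ}
    (ht : θ + t • h ∈ U) :
    HasDerivAt (fun t : ℝ => φ (θ + t • h)) (fderiv ℝ φ (θ + t • h) h) t := by
  have h1 : DifferentiableAt ℝ φ (θ + t • h) :=
    (hφ.contDiffAt (hU.mem_nhds ht)).differentiableAt (by simp)
  have h2 : HasDerivAt (fun t : ℝ => θ + t • h) h t := by
    simpa using ((hasDerivAt_id t).smul_const h).const_add θ
  exact h1.hasFDerivAt.comp_hasDerivAt t h2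

theorem hasDerivAt_fderiv_comp_line (hU : IsOpen U) (hφ : ContDiffOn ℝ 2 φ U) {θ h : E} {t : ℝ}
    (ht : θ + t • h ∈ U) :
    HasDerivAt (fun t : ℝ => fderiv ℝ φ (θ + t • h) h)
      (fderiv ℝ (fderiv ℝ φ) (θ + t • h) h h) t := by
  have h1 : DifferentiableAt ℝ (fderiv ℝ φ) (θ + t • h) :=
    ((hφ.contDiffAt (hU.mem_nhds ht)).fderiv_right (m := 1) (by norm_num)).differentiableAt
      (by simp)
  have h2 : HasDerivAt (fun t : ℝ => θ + t • h) h t := by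
    simpa using ((hasDerivAt_id t).smul_const h).const_add θ
  have h3 : HasDerivAt (fun t : ℝ => fderiv ℝ φ (θ + t • h))
      (fderiv ℝ (fderiv ℝ φ) (θ + t • h) h) t := h1.hasFDerivAt.comp_hasDerivAt t h2
  simpa using h3.clm_apply (hasDerivAt_const t h)

theorem le_of_fderiv_fderiv_le (hU : IsOpen U) (hφ : ContDiffOn ℝ 2 φ U) {θ h : E} {A : ℝ}
    (hseg : ∀ t ∈ Set.Icc (0 : ℝ) 1, θ + t • h ∈ U)
    (hA : ∀ t ∈ Set.Icc (0 : ℝ) 1, fderiv ℝ (fderiv ℝ φ) (θ + t • h) h h ≤ A) :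
    φ (θ + h) ≤ φ θ + fderiv ℝ φ θ h + A / 2 := by
  have := taylor_le_of_second_deriv_le (f := fun t : ℝ => φ (θ + t • h))
    (fun t ht => hasDerivAt_comp_line hU hφ (hseg t ht))
    (fun t ht => hasDerivAt_fderiv_comp_line hU hφ (hseg t ht)) hA
  simpa using this

theorem continuousOn_fderiv_fderiv (hU : IsOpen U) (hφ : ContDiffOn ℝ 2 φ U) :
    ContinuousOn (fderiv ℝ (fderiv ℝ φ)) U :=
  ((hφ.fderiv_of_isOpen (m := 1) hU (by norm_num)).continuousOn_fderiv_of_isOpen hU le_rfl)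

/-- A quadratic upper bound, uniform over a compact set of base points. -/
theorem exists_quadratic_upper_bound [ProperSpace E] (hU : IsOpen U) (hφ : ContDiffOn ℝ 2 φ U)
    {K : Set E} (hK : IsCompact K) (hKU : K ⊆ U) :
    ∃ δ > 0, ∃ C > 0, ∀ θ ∈ K, ∀ h : E, ‖h‖ ≤ δ →
      θ + h ∈ U ∧ φ (θ + h) ≤ φ θ + fderiv ℝ φ θ h + C * ‖h‖ ^ 2 / 2 := by
  -- A closed thickening of `K` inside `U` is still compact, so one bound on the second derivative
  -- serves all segments of length at most `δ` issuing from `K`.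
  obtain ⟨δ, hδ, hδU⟩ := hK.exists_cthickening_subset_open hU hKU
  have hmem : ∀ θ ∈ K, ∀ h : E, ‖h‖ ≤ δ → θ + h ∈ Metric.cthickening δ K := fun θ hθ h hh =>
    Metric.mem_cthickening_of_dist_le _ θ _ _ hθ (by simpa [dist_eq_norm] using hh)
  have hcont : ContinuousOn (fun η => ‖fderiv ℝ (fderiv ℝ φ) η‖) (Metric.cthickening δ K) :=
    (continuous_norm (E := E →L[ℝ] E →L[ℝ] ℝ)).comp_continuousOn
      ((continuousOn_fderiv_fderiv hU hφ).mono hδU)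
  obtain ⟨C, hC⟩ := hK.cthickening.exists_bound_of_continuousOn hcont
  refine ⟨δ, hδ, max C 1, by positivity, fun θ hθ h hh => ⟨hδU (hmem θ hθ h hh), ?_⟩⟩
  have hmem' : ∀ t ∈ Set.Icc (0 : ℝ) 1, θ + t • h ∈ Metric.cthickening δ K := by
    intro t ht
    refine hmem θ hθ _ ?_
    rw [norm_smul, Real.norm_of_nonneg ht.1]
    exact (mul_le_of_le_one_left (norm_nonneg _) ht.2).trans hh
  refine le_of_fderiv_fderiv_le hU hφ (fun t ht => hδU (hmem' t ht)) fun t ht => ?_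
  calc fderiv ℝ (fderiv ℝ φ) (θ + t • h) h h
      ≤ ‖fderiv ℝ (fderiv ℝ φ) (θ + t • h) h h‖ := Real.le_norm_self _
    _ ≤ ‖fderiv ℝ (fderiv ℝ φ) (θ + t • h)‖ * ‖h‖ * ‖h‖ := ContinuousLinearMap.le_opNorm₂ _ _ _
    _ ≤ max C 1 * ‖h‖ ^ 2 := by
      rw [mul_assoc, ← sq]
      gcongr
      exact (Real.le_norm_self _).trans ((hC _ (hmem' t ht)).trans (le_max_left _ _))

/-- The second order Taylor upper bound with an error `ε ‖h‖²`. -/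
theorem eventually_second_order_upper_bound (hU : IsOpen U) (hφ : ContDiffOn ℝ 2 φ U)
    {θ : E} (hθ : θ ∈ U) {ε : ℝ} (hε : 0 < ε) :
    ∃ δ > 0, ∀ h : E, ‖h‖ ≤ δ → θ + h ∈ U ∧
      φ (θ + h) ≤ φ θ + fderiv ℝ φ θ h
        + (fderiv ℝ (fderiv ℝ φ) θ h h + ε * ‖h‖ ^ 2) / 2 := by
  have h1 : ∀ᶠ η in 𝓝 θ, η ∈ U ∧
      ‖fderiv ℝ (fderiv ℝ φ) η - fderiv ℝ (fderiv ℝ φ) θ‖ < ε := by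
    have h2 : ContinuousAt (fderiv ℝ (fderiv ℝ φ)) θ :=
      (continuousOn_fderiv_fderiv hU hφ).continuousAt (hU.mem_nhds hθ)
    have h3 : ContinuousAt (fun η => ‖fderiv ℝ (fderiv ℝ φ) η - fderiv ℝ (fderiv ℝ φ) θ‖) θ :=
      (continuous_norm (E := E →L[ℝ] E →L[ℝ] ℝ)).continuousAt.comp (h2.sub continuousAt_const)
    refine (hU.eventually_mem hθ).and (h3.eventually_lt continuousAt_const ?_)
    rw [sub_self]
    exact (norm_zero (E := E →L[ℝ] E →L[ℝ] ℝ)).trans_lt hε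
  obtain ⟨δ, hδ, hb⟩ := Metric.nhds_basis_closedBall.eventually_iff.1 h1
  have hmem : ∀ h : E, ‖h‖ ≤ δ → θ + h ∈ Metric.closedBall θ δ := fun h hh => by simpa using hh
  refine ⟨δ, hδ, fun h hh => ⟨(hb (hmem h hh)).1, ?_⟩⟩
  have hmem' : ∀ t ∈ Set.Icc (0 : ℝ) 1, θ + t • h ∈ Metric.closedBall θ δ := by
    intro t ht
    refine hmem _ ?_
    rw [norm_smul, Real.norm_of_nonneg ht.1]
    exact (mul_le_of_le_one_left (norm_nonneg _) ht.2).trans hh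
  refine le_of_fderiv_fderiv_le hU hφ (fun t ht => (hb (hmem' t ht)).1) fun t ht => ?_
  have h2 : (fderiv ℝ (fderiv ℝ φ) (θ + t • h) - fderiv ℝ (fderiv ℝ φ) θ) h h
      ≤ ε * ‖h‖ ^ 2 := by
    refine (Real.le_norm_self _).trans ((ContinuousLinearMap.le_opNorm₂ _ _ _).trans ?_)
    rw [mul_assoc, ← sq]
    gcongr
    exact (hb (hmem' t ht)).2.le
  simp only [sub_apply] at h2
  linarith

end Taylor

/-! ### Truncated Gaussian integrals. -/

section Window

variable {E : Type*} [NormedAddCommGroup E] [InnerProductSpace ℝ E] [FiniteDimensional ℝ E]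
  [MeasurableSpace E] [BorelSpace E]

/-- The truncated Gaussian integral `∫_{‖u‖ ≤ M} exp(⟨u, x⟩ - ‖A u‖² / 2) du`. -/
noncomputable def gaussWindow (A : E →L[ℝ] E) (M : ℝ) (x : E) : ℝ :=
  ∫ u in Metric.closedBall 0 M, Real.exp (inner ℝ u x - ‖A u‖ ^ 2 / 2)

variable (A : E →L[ℝ] E)

theorem integrableOn_gaussWindow (M : ℝ) (x : E) :
    IntegrableOn (fun u => Real.exp (inner ℝ u x - ‖A u‖ ^ 2 / 2)) (Metric.closedBall 0 M) :=
  ContinuousOn.integrableOn_compact (isCompact_closedBall 0 M) (by fun_prop)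

theorem continuous_gaussWindow (M : ℝ) : Continuous (gaussWindow A M) := by
  refine continuous_parametric_integral_of_continuous
    (f := fun x u : E => Real.exp (inner ℝ u x - ‖A u‖ ^ 2 / 2)) ?_ (isCompact_closedBall 0 M)
  change Continuous fun p : E × E => Real.exp (inner ℝ p.2 p.1 - ‖A p.2‖ ^ 2 / 2)
  fun_prop

theorem ofReal_gaussWindow (M : ℝ) (x : E) :
    ENNReal.ofReal (gaussWindow A M x) =
      ∫⁻ u in Metric.closedBall 0 M, ENNReal.ofReal (Real.exp (inner ℝ u x - ‖A u‖ ^ 2 / 2)) :=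
  ofReal_integral_eq_lintegral_ofReal (integrableOn_gaussWindow A M x)
    (Eventually.of_forall fun _ => (Real.exp_pos _).le)

theorem gaussWindow_mono {M M' : ℝ} (h : M ≤ M') (x : E) :
    gaussWindow A M x ≤ gaussWindow A M' x :=
  setIntegral_mono_set (integrableOn_gaussWindow A M' x)
    (Eventually.of_forall fun _ => (Real.exp_pos _).le)
    (Metric.closedBall_subset_closedBall h).eventuallyLE

theorem gaussWindow_zero_pos {M : ℝ} (hM : 0 < M) : 0 < gaussWindow A M 0 := by
  unfold gaussWindow
  rw [setIntegral_pos_iff_support_of_nonneg_ae (Eventually.of_forall fun _ => (Real.exp_pos _).le)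
    (integrableOn_gaussWindow A M 0)]
  have : (Function.support fun u : E => Real.exp (inner ℝ u (0 : E) - ‖A u‖ ^ 2 / 2)) = Set.univ :=
    Set.eq_univ_of_forall fun u => (Real.exp_pos _).ne'
  rw [this, Set.univ_inter]
  exact Metric.measure_closedBall_pos _ _ hM

theorem gaussWindow_neg (M : ℝ) (x : E) : gaussWindow A M (-x) = gaussWindow A M x := by
  unfold gaussWindow
  rw [← integral_indicator Metric.isClosed_closedBall.measurableSet,
    ← integral_indicator Metric.isClosed_closedBall.measurableSet,
    ← integral_neg_eq_self]
  congr 1 with u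
  simp [Set.indicator]

/-- Averaging the values at `x` and `-x` replaces `exp ⟨u, x⟩` by `cosh ⟨u, x⟩ ≥ 1`. This bounds
negative powers of the window with no control on the score. -/
theorem gaussWindow_zero_le (M : ℝ) (x : E) : gaussWindow A M 0 ≤ gaussWindow A M x := by
  have h : 2 * gaussWindow A M 0 ≤ gaussWindow A M x + gaussWindow A M (-x) := by
    unfold gaussWindow
    rw [← integral_add (integrableOn_gaussWindow A M x) (integrableOn_gaussWindow A M (-x)),
      ← integral_const_mul]
    refine integral_mono ((integrableOn_gaussWindow A M 0).const_mul 2)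
      ((integrableOn_gaussWindow A M x).add (integrableOn_gaussWindow A M (-x))) fun u => ?_
    simp only [inner_zero_right, inner_neg_right, sub_eq_add_neg, Real.exp_add, Real.exp_zero,
      one_mul, ← add_mul]
    gcongr
    have h1 := Real.add_one_le_exp (inner ℝ u x)
    have h2 := Real.add_one_le_exp (-inner ℝ u x)
    linarith
  rw [gaussWindow_neg] at h
  linarith

theorem gaussWindow_pos {M : ℝ} (hM : 0 < M) (x : E) : 0 < gaussWindow A M x :=
  (gaussWindow_zero_pos A hM).trans_le (gaussWindow_zero_le A M x)

theorem integrable_exp_inner_sub (ξ : E) :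
    Integrable fun v : E => Real.exp (inner ℝ v ξ - ‖v‖ ^ 2 / 2) := by
  have h := GaussianFourier.integrable_cexp_neg_mul_sq_norm_add (V := E) (b := 1 / 2)
    (by norm_num) 1 ξ
  refine h.re.congr (Eventually.of_forall fun v => ?_)
  have : (-(1 / 2) * (‖v‖ : ℂ) ^ 2 + 1 * (inner ℝ ξ v : ℝ) : ℂ)
      = ((inner ℝ v ξ - ‖v‖ ^ 2 / 2 : ℝ) : ℂ) := by
    rw [real_inner_comm]; push_cast; ring
  change (Complex.exp (-(1 / 2) * (‖v‖ : ℂ) ^ 2 + 1 * (inner ℝ ξ v : ℝ))).re = _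
  rw [this, ← Complex.ofReal_exp, Complex.ofReal_re]

/-- Complete the square and translate by `ξ`. -/
theorem integral_exp_inner_sub (ξ : E) :
    ∫ v : E, Real.exp (inner ℝ v ξ - ‖v‖ ^ 2 / 2)
      = (2 * Real.pi) ^ (Module.finrank ℝ E / 2 : ℝ) * Real.exp (‖ξ‖ ^ 2 / 2) := by
  have h1 : ∀ v : E, inner ℝ v ξ - ‖v‖ ^ 2 / 2 = -(1 / 2) * ‖v - ξ‖ ^ 2 + ‖ξ‖ ^ 2 / 2 := by
    intro v
    rw [norm_sub_sq_real]; ring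
  simp_rw [h1, Real.exp_add]
  rw [integral_mul_const, integral_sub_right_eq_self (fun v : E => Real.exp (-(1 / 2) * ‖v‖ ^ 2)),
    GaussianFourier.integral_rexp_neg_mul_sq_norm (by norm_num)]
  congr 2
  ring

variable {A}

theorem integrable_exp_inner_sub_comp (hdet : LinearMap.det (A : E →ₗ[ℝ] E) ≠ 0) (ξ : E) :
    Integrable fun u : E => Real.exp (inner ℝ (A u) ξ - ‖A u‖ ^ 2 / 2) := by
  have h := integrable_exp_inner_sub ξ
  have hmap := Measure.map_linearMap_addHaar_eq_smul_addHaar (volume : Measure E) hdet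
  have h2 : Integrable (fun v : E => Real.exp (inner ℝ v ξ - ‖v‖ ^ 2 / 2))
      (Measure.map (A : E →ₗ[ℝ] E) volume) := by
    rw [hmap]
    exact h.smul_measure ENNReal.ofReal_ne_top
  exact h2.comp_measurable A.measurable

/-- Substitute `v = A u`; the Jacobian contributes `|det A|⁻¹`. -/
theorem integral_exp_inner_sub_comp (hdet : LinearMap.det (A : E →ₗ[ℝ] E) ≠ 0) (ξ : E) :
    ∫ u : E, Real.exp (inner ℝ (A u) ξ - ‖A u‖ ^ 2 / 2)
      = |(LinearMap.det (A : E →ₗ[ℝ] E))⁻¹| *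
        ((2 * Real.pi) ^ (Module.finrank ℝ E / 2 : ℝ) * Real.exp (‖ξ‖ ^ 2 / 2)) := by
  have hmap := Measure.map_linearMap_addHaar_eq_smul_addHaar (volume : Measure E) hdet
  have h2 : ∫ u : E, Real.exp (inner ℝ (A u) ξ - ‖A u‖ ^ 2 / 2)
      = ∫ v, Real.exp (inner ℝ v ξ - ‖v‖ ^ 2 / 2) ∂(Measure.map (A : E →ₗ[ℝ] E) volume) := by
    symm
    exact integral_map A.measurable.aemeasurable (by fun_prop)
  rw [h2, hmap, integral_smul_measure, integral_exp_inner_sub, smul_eq_mul,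
    ENNReal.toReal_ofReal (abs_nonneg _)]

/-- Symmetry turns `⟨u, A ξ⟩` into `⟨A u, ξ⟩`, so the integrand depends on `A u` only; the balls
then exhaust the space. -/
theorem tendsto_gaussWindow (hdet : LinearMap.det (A : E →ₗ[ℝ] E) ≠ 0)
    (hA : (A : E →ₗ[ℝ] E).IsSymmetric) (ξ : E) :
    Tendsto (fun m : ℕ => gaussWindow A m (A ξ)) atTop
      (𝓝 (|(LinearMap.det (A : E →ₗ[ℝ] E))⁻¹| *
        ((2 * Real.pi) ^ (Module.finrank ℝ E / 2 : ℝ) * Real.exp (‖ξ‖ ^ 2 / 2)))) := by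
  have hin : ∀ u : E, inner ℝ u (A ξ) = inner ℝ (A u) ξ := fun u => (hA u ξ).symm
  unfold gaussWindow
  simp_rw [hin]
  rw [← integral_exp_inner_sub_comp hdet]
  have h := tendsto_setIntegral_of_monotone (μ := (volume : Measure E))
    (s := fun m : ℕ => Metric.closedBall (0 : E) m)
    (f := fun u : E => Real.exp (inner ℝ (A u) ξ - ‖A u‖ ^ 2 / 2))
    (fun m => Metric.isClosed_closedBall.measurableSet)
    (fun m m' hm => Metric.closedBall_subset_closedBall (by exact_mod_cast hm))
    (integrable_exp_inner_sub_comp hdet ξ).integrableOn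
  rwa [Metric.iUnion_closedBall_nat, setIntegral_univ] at h

end Window

/-! ### Exponential moments of `-‖ξ‖²` under the standard Gaussian. -/

section StdGaussian

open ProbabilityTheory

/-- The factor turns the density into an unnormalized Gaussian of variance `1 / (1 + s)`. -/
theorem integral_gaussianReal_exp_neg_mul_sq {s : ℝ} (hs : 0 < s) :
    ∫ x, Real.exp (-(s * x ^ 2 / 2)) ∂(gaussianReal 0 1) = (1 + s) ^ (-(1 / 2) : ℝ) := by
  rw [integral_gaussianReal_eq_integral_smul (by simp)]
  have h : ∀ x : ℝ, gaussianPDFReal 0 1 x • Real.exp (-(s * x ^ 2 / 2))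
      = (√(2 * Real.pi))⁻¹ * Real.exp (-((1 + s) / 2) * x ^ 2) := by
    intro x
    simp only [gaussianPDFReal, NNReal.coe_one, mul_one, sub_zero, smul_eq_mul]
    rw [mul_assoc, ← Real.exp_add]
    congr 2
    ring
  simp_rw [h]
  rw [integral_const_mul, integral_gaussian, ← Real.sqrt_inv, ← Real.sqrt_mul (by positivity),
    Real.rpow_neg (by positivity), ← Real.sqrt_eq_rpow, ← Real.sqrt_inv]
  congr 1
  field_simp

theorem integral_stdGaussian_exp_neg_mul_sq (k : ℕ) {s : ℝ} (hs : 0 < s) :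
    ∫ ξ, Real.exp (-(s * ‖ξ‖ ^ 2 / 2)) ∂(stdGaussian (EuclideanSpace ℝ (Fin k)))
      = (1 + s) ^ (-(k / 2) : ℝ) := by
  rw [← map_pi_eq_stdGaussian, integral_map (by fun_prop) (by fun_prop)]
  have h : ∀ x : Fin k → ℝ, Real.exp (-(s * ‖WithLp.toLp 2 x‖ ^ 2 / 2))
      = ∏ i, Real.exp (-(s * x i ^ 2 / 2)) := by
    intro x
    rw [EuclideanSpace.real_norm_sq_eq, ← Real.exp_sum, Finset.sum_neg_distrib,
      ← Finset.sum_div, ← Finset.mul_sum]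
  simp_rw [h]
  rw [integral_fintype_prod_eq_pow (fun x : ℝ => Real.exp (-(s * x ^ 2 / 2))),
    integral_gaussianReal_exp_neg_mul_sq hs, ← Real.rpow_natCast, ← Real.rpow_mul (by positivity)]
  congr 1
  simp
  ring

end StdGaussian

/-! ### Rényi divergence from a pointwise likelihood bound. -/

section Renyi

variable {Z : Type*} [MeasurableSpace Z] (μ : Measure Z)

/-- If `p · c ≤ q` pointwise, then `D_{1+s}(p‖q) ≤ s⁻¹ log ∫ p c^{-s}`. -/
theorem renyiDiv_le_of_mul_le {s : ℝ} (hs : 0 < s) {p q : Z → ℝ≥0∞} {c : Z → ℝ} {B : ℝ}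
    (hB : 0 < B) (hc : ∀ z, 0 < c z)
    (h : ∀ z, p z * ENNReal.ofReal (c z) ≤ q z)
    (hint : ∫⁻ z, p z * ENNReal.ofReal (c z ^ (-s)) ∂μ ≤ ENNReal.ofReal B) :
    renyiDiv μ (1 + s) p q ≤ ((s⁻¹ * Real.log B : ℝ) : EReal) := by
  have hpt : ∀ z, p z * (p z / q z) ^ (1 + s - 1) ≤ p z * ENNReal.ofReal (c z ^ (-s)) := by
    intro z
    rw [add_sub_cancel_left]
    gcongr
    have h1 : p z / q z ≤ ENNReal.ofReal (c z)⁻¹ := by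
      rcases eq_or_ne (p z) 0 with h0 | h0
      · simp [h0]
      refine ENNReal.div_le_of_le_mul ?_
      calc p z = ENNReal.ofReal (c z)⁻¹ * (p z * ENNReal.ofReal (c z)) := by
            rw [mul_comm, mul_assoc, ← ENNReal.ofReal_mul (hc z).le, mul_inv_cancel₀ (hc z).ne',
              ENNReal.ofReal_one, mul_one]
        _ ≤ _ := by gcongr; exact h z
    calc (p z / q z) ^ s ≤ ENNReal.ofReal (c z)⁻¹ ^ s := ENNReal.rpow_le_rpow h1 hs.le
      _ = ENNReal.ofReal (c z ^ (-s)) := by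
        rw [ENNReal.ofReal_rpow_of_pos (inv_pos.2 (hc z)), Real.inv_rpow (hc z).le,
          Real.rpow_neg (hc z).le]
  unfold renyiDiv
  rw [EReal.coe_mul, add_sub_cancel_left, ← ENNReal.log_ofReal_of_pos hB]
  refine mul_le_mul_of_nonneg_left (ENNReal.log_monotone ?_)
    (by exact_mod_cast (inv_pos.2 hs).le)
  refine (lintegral_mono fun z => ?_).trans hint
  simpa using hpt z

end Renyi

/-! ### Product densities and product measures. -/

section Product

variable {Y : Type*} [MeasurableSpace Y] {μ : Measure Y} [SigmaFinite μ]

/-- The law with density `iidDensity p n` is the `n`-fold product of the law with density `p`. -/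
theorem pi_withDensity_eq {p : Y → ℝ≥0∞} (hp : Measurable p) (hfin : ∀ y, p y ≠ ⊤)
    (hint : ∫⁻ y, p y ∂μ ≠ ⊤) (n : ℕ) :
    (Measure.pi fun _ : Fin n => μ).withDensity (iidDensity p n)
      = Measure.pi fun _ : Fin n => μ.withDensity p := by
  have : IsFiniteMeasure (μ.withDensity p) := isFiniteMeasure_withDensity hint
  symm
  refine Measure.pi_eq fun s hs => ?_
  have hsm : MeasurableSet (Set.univ.pi s) := MeasurableSet.univ_pi hs
  -- It suffices to compare masses of boxes. Passing to real-valued densities, finite by `hfin`,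
  -- lets the product formula for Bochner integrals compute them.
  have hq : Integrable (fun y => (p y).toReal) μ :=
    integrable_toReal_of_lintegral_ne_top hp.aemeasurable hint
  have hqi : ∀ i, Integrable ((s i).indicator fun y => (p y).toReal) μ :=
    fun i => hq.indicator (hs i)
  have hnn : ∀ i y, 0 ≤ (s i).indicator (fun y => (p y).toReal) y := fun i y =>
    Set.indicator_nonneg (fun _ _ => ENNReal.toReal_nonneg) y
  have hpt : ∀ i y, ENNReal.ofReal ((s i).indicator (fun y => (p y).toReal) y)
      = (s i).indicator p y := by
    intro i y
    by_cases hy : y ∈ s i <;> simp [hy, hfin]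
  have hone : ∀ i, ENNReal.ofReal (∫ y, (s i).indicator (fun y => (p y).toReal) y ∂μ)
      = μ.withDensity p (s i) := by
    intro i
    rw [ofReal_integral_eq_lintegral_ofReal (hqi i) (Eventually.of_forall (hnn i)),
      withDensity_apply _ (hs i), ← lintegral_indicator (hs i)]
    simp_rw [hpt]
  simp_rw [← hone]
  rw [← ENNReal.ofReal_prod_of_nonneg fun i _ => integral_nonneg (hnn i),
    ← integral_fintype_prod_eq_prod (𝕜 := ℝ) (fun i y => (s i).indicator (fun y => (p y).toReal) y),
    ofReal_integral_eq_lintegral_ofReal (Integrable.fintype_prod hqi)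
      (Eventually.of_forall fun y => Finset.prod_nonneg fun i _ => hnn i (y i)),
    withDensity_apply _ hsm, ← lintegral_indicator hsm]
  refine lintegral_congr fun y => ?_
  rw [ENNReal.ofReal_prod_of_nonneg fun i _ => hnn i (y i)]
  simp_rw [hpt]
  by_cases hy : y ∈ Set.univ.pi s
  · rw [Set.indicator_of_mem hy]
    exact Finset.prod_congr rfl fun i _ => (Set.indicator_of_mem (hy i trivial) _).symm
  · rw [Set.indicator_of_notMem hy]
    simp only [Set.mem_pi, Set.mem_univ, true_imp_iff, not_forall] at hy
    obtain ⟨i, hi⟩ := hy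
    exact (Finset.prod_eq_zero (Finset.mem_univ i) (Set.indicator_of_notMem hi _)).symm

theorem measurable_iidDensity {p : Y → ℝ≥0∞} (hp : Measurable p) (n : ℕ) :
    Measurable (iidDensity p n) :=
  Finset.measurable_prod _ fun i _ => hp.comp (measurable_pi_apply i)

theorem lintegral_iidDensity_mul {p : Y → ℝ≥0∞} (hp : Measurable p) (hfin : ∀ y, p y ≠ ⊤)
    (hint : ∫⁻ y, p y ∂μ ≠ ⊤) (n : ℕ) {f : (Fin n → Y) → ℝ≥0∞} (hf : Measurable f) :
    ∫⁻ y, iidDensity p n y * f y ∂(Measure.pi fun _ : Fin n => μ)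
      = ∫⁻ y, f y ∂(Measure.pi fun _ : Fin n => μ.withDensity p) := by
  rw [← pi_withDensity_eq hp hfin hint,
    lintegral_withDensity_eq_lintegral_mul _ (measurable_iidDensity hp n) hf]
  rfl

end Product

/-! ### Pointwise lower bound for the mixture density. -/

section Mixture

variable {k : ℕ} {Y : Type*} (p₀ : Y → ℝ≥0) (g : Fin k → Y → ℝ)
  (φ : EuclideanSpace ℝ (Fin k) → ℝ)

/-- The vector `(g₁(y), …, g_k(y))`. -/
noncomputable def suffStat (y : Y) : EuclideanSpace ℝ (Fin k) := WithLp.toLp 2 fun j => g j y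

theorem sum_mul_eq_inner (θ : EuclideanSpace ℝ (Fin k)) (y : Y) :
    ∑ j, θ j * g j y = inner ℝ θ (suffStat g y) := by
  simp [suffStat, PiLp.inner_apply, mul_comm]

theorem expDensity_ne_top (θ : EuclideanSpace ℝ (Fin k)) (y : Y) :
    expDensity p₀ g φ θ y ≠ ⊤ := by
  unfold expDensity
  finiteness

/-- A parameter shift is an exponential tilt. The identity is algebraic and needs no membership in
`Θ`. -/
theorem expDensity_add (θ h : EuclideanSpace ℝ (Fin k)) (y : Y) :
    expDensity p₀ g φ (θ + h) y = expDensity p₀ g φ θ y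
      * ENNReal.ofReal (Real.exp (inner ℝ h (suffStat g y) - (φ (θ + h) - φ θ))) := by
  unfold expDensity
  rw [mul_assoc, ← ENNReal.ofReal_mul (Real.exp_pos _).le, ← Real.exp_add, sum_mul_eq_inner,
    sum_mul_eq_inner, inner_add_left]
  congr 3
  ring

theorem iidDensity_expDensity_add (θ h : EuclideanSpace ℝ (Fin k)) (n : ℕ) (y : Fin n → Y) :
    iidDensity (expDensity p₀ g φ (θ + h)) n y = iidDensity (expDensity p₀ g φ θ) n y
      * ENNReal.ofReal (Real.exp (inner ℝ h (∑ i, suffStat g (y i)) - n * (φ (θ + h) - φ θ))) := by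
  unfold iidDensity
  simp_rw [expDensity_add p₀ g φ θ h]
  rw [Finset.prod_mul_distrib, ← ENNReal.ofReal_prod_of_nonneg fun i _ => (Real.exp_pos _).le,
    ← Real.exp_sum, Finset.sum_sub_distrib, ← inner_sum]
  simp [mul_sub]

/-- The normalized statistic `n^{-1/2} ∑ (g(y_i) - ∇φ(θ))`. -/
noncomputable def score (θ : EuclideanSpace ℝ (Fin k)) (n : ℕ) (y : Fin n → Y) :
    EuclideanSpace ℝ (Fin k) :=
  (√n)⁻¹ • ∑ i, (suffStat g (y i) - gradient φ θ)

/-- With `r = 1/√n` this produces the factor `n^{-k/2}`. `F` may be non-measurable because scaling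
is a homeomorphism. -/
theorem lintegral_comp_add_smul {E : Type*} [NormedAddCommGroup E] [InnerProductSpace ℝ E]
    [FiniteDimensional ℝ E] [MeasurableSpace E] [BorelSpace E] (F : E → ℝ≥0∞) (θ : E) {r : ℝ}
    (hr : 0 < r) :
    ∫⁻ η, F η = ENNReal.ofReal (r ^ Module.finrank ℝ E) * ∫⁻ u, F (θ + r • u) := by
  have h1 : ∫⁻ u, F (θ + r • u) = ∫⁻ v, F (θ + v) ∂(Measure.map (r • ·) (volume : Measure E)) :=
    ((Homeomorph.smulOfNeZero r hr.ne').measurableEmbedding.lintegral_map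
      (fun v => F (θ + v))).symm
  rw [h1, Measure.map_addHaar_smul _ hr.ne', lintegral_smul_measure,
    lintegral_add_left_eq_self, smul_eq_mul, ← mul_assoc,
    ← ENNReal.ofReal_mul (by positivity), abs_of_pos (by positivity),
    mul_inv_cancel₀ (by positivity), ENNReal.ofReal_one, one_mul]

/-- The mixture density dominates the density at `θ` times a truncated Gaussian integral. -/
theorem mul_gaussWindow_le_mixtureDensity {Θ : Set (EuclideanSpace ℝ (Fin k))}
    (hΘ : MeasurableSet Θ) {w : EuclideanSpace ℝ (Fin k) → ℝ}
    {A : EuclideanSpace ℝ (Fin k) →L[ℝ] EuclideanSpace ℝ (Fin k)}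
    {θ : EuclideanSpace ℝ (Fin k)} {n : ℕ} (hn : 0 < n) {M w₁ ε : ℝ} (hw₁ : 0 ≤ w₁)
    (hmem : ∀ u, ‖u‖ ≤ M → θ + (√n)⁻¹ • u ∈ Θ ∧ w₁ ≤ w (θ + (√n)⁻¹ • u) ∧
      n * (φ (θ + (√n)⁻¹ • u) - φ θ - fderiv ℝ φ θ ((√n)⁻¹ • u)) ≤ ‖A u‖ ^ 2 / 2 + ε)
    (y : Fin n → Y) :
    iidDensity (expDensity p₀ g φ θ) n y * ENNReal.ofReal
        ((n : ℝ) ^ (-(k / 2) : ℝ) * (w₁ * Real.exp (-ε)) * gaussWindow A M (score g φ θ n y))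
      ≤ mixtureDensity Θ w (expDensity p₀ g φ) n y := by
  have hn' : (0 : ℝ) < n := by exact_mod_cast hn
  have hr : 0 < (√n : ℝ)⁻¹ := inv_pos.2 (Real.sqrt_pos.2 hn')
  have hpow : (n : ℝ) ^ (-(k / 2) : ℝ)
      = (√n : ℝ)⁻¹ ^ Module.finrank ℝ (EuclideanSpace ℝ (Fin k)) := by
    rw [finrank_euclideanSpace_fin, ← Real.rpow_natCast, Real.inv_rpow (Real.sqrt_nonneg _),
      Real.sqrt_eq_rpow, ← Real.rpow_mul hn'.le, Real.rpow_neg hn'.le]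
    congr 2
    ring
  unfold mixtureDensity
  rw [← lintegral_indicator hΘ, lintegral_comp_add_smul _ θ hr, ← hpow, mul_assoc,
    ENNReal.ofReal_mul (by positivity), mul_left_comm]
  gcongr
  rw [ENNReal.ofReal_mul (by positivity), ofReal_gaussWindow,
    ← lintegral_const_mul _ (by fun_prop), ← lintegral_const_mul _ (by fun_prop),
    ← lintegral_indicator Metric.isClosed_closedBall.measurableSet]
  refine lintegral_mono fun u => ?_
  by_cases hu : ‖u‖ ≤ M
  swap
  · rw [Set.indicator_of_notMem (by simpa using hu)]
    exact zero_le
  obtain ⟨h1, h2, h3⟩ := hmem u hu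
  rw [Set.indicator_of_mem (by simpa using hu), Set.indicator_of_mem h1,
    iidDensity_expDensity_add, mul_assoc]
  refine mul_le_mul' le_rfl ?_
  rw [← ENNReal.ofReal_mul (by positivity), ← ENNReal.ofReal_mul (by positivity)]
  refine ENNReal.ofReal_le_ofReal ?_
  -- The linear Taylor term of `n φ` is exactly the centering of the sufficient statistic.
  have hscore : inner ℝ u (score g φ θ n y) = inner ℝ ((√n)⁻¹ • u) (∑ i, suffStat g (y i))
      - n * fderiv ℝ φ θ ((√n)⁻¹ • u) := by
    have hg : ∀ v, fderiv ℝ φ θ v = inner ℝ v (gradient φ θ) := by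
      intro v
      rw [real_inner_comm, gradient, InnerProductSpace.toDual_symm_apply]
    rw [score, Finset.sum_sub_distrib, inner_smul_right, inner_sub_right, hg, inner_smul_left,
      inner_smul_left]
    simp [inner_smul_right, ← Nat.cast_smul_eq_nsmul ℝ]
    ring
  calc w₁ * Real.exp (-ε) * Real.exp (inner ℝ u (score g φ θ n y) - ‖A u‖ ^ 2 / 2)
      = Real.exp (inner ℝ u (score g φ θ n y) - (‖A u‖ ^ 2 / 2 + ε)) * w₁ := by
        rw [mul_assoc, ← Real.exp_add, mul_comm]
        congr 2
        ring
    _ ≤ _ := by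
        refine mul_le_mul (Real.exp_le_exp.2 ?_) h2 hw₁ (Real.exp_pos _).le
        rw [hscore]
        linarith

end Mixture

/-! ### Moments and characteristic functions of the sufficient statistic. -/

section Family

open ProbabilityTheory

variable {k : ℕ} {Y : Type*} [MeasurableSpace Y] {μ : Measure Y}
  {p₀ : Y → ℝ≥0} {g : Fin k → Y → ℝ} {φ : EuclideanSpace ℝ (Fin k) → ℝ}
  {Θ : Set (EuclideanSpace ℝ (Fin k))}

namespace IsExponentialFamily

variable (hfam : IsExponentialFamily μ p₀ g φ Θ)

include hfam

theorem measurable_suffStat : Measurable (suffStat g) :=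
  (WithLp.measurable_toLp 2 _).comp (measurable_pi_lambda _ hfam.measurable_generator)

theorem measurable_expDensity (θ : EuclideanSpace ℝ (Fin k)) :
    Measurable (expDensity p₀ g φ θ) := by
  have h1 := hfam.measurable_base
  have h2 := hfam.measurable_suffStat
  unfold expDensity
  simp_rw [sum_mul_eq_inner]
  fun_prop

theorem lintegral_expDensity {θ : EuclideanSpace ℝ (Fin k)} (hθ : θ ∈ Θ) :
    ∫⁻ y, expDensity p₀ g φ θ y ∂μ = 1 := by
  have h : ∀ y, expDensity p₀ g φ θ y = (p₀ y : ℝ≥0∞)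
      * ENNReal.ofReal (Real.exp (∑ j, θ j * g j y)) * ENNReal.ofReal (Real.exp (-φ θ)) := by
    intro y
    rw [expDensity, mul_assoc, ← ENNReal.ofReal_mul (Real.exp_pos _).le, ← Real.exp_add,
      sub_eq_add_neg]
  have h1 := hfam.measurable_base
  have h2 := hfam.measurable_suffStat
  simp_rw [h]
  rw [lintegral_mul_const _ (by simp_rw [sum_mul_eq_inner]; fun_prop), hfam.exp_potential θ hθ,
    ← ENNReal.ofReal_mul (Real.exp_pos _).le, ← Real.exp_add]
  simp

end IsExponentialFamily

/-- The law `P_θ`. -/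
noncomputable def expLaw (μ : Measure Y) (p₀ : Y → ℝ≥0) (g : Fin k → Y → ℝ)
    (φ : EuclideanSpace ℝ (Fin k) → ℝ) (θ : EuclideanSpace ℝ (Fin k)) : Measure Y :=
  μ.withDensity (expDensity p₀ g φ θ)

namespace IsExponentialFamily

variable (hfam : IsExponentialFamily μ p₀ g φ Θ)

include hfam

theorem isProbabilityMeasure_expLaw {θ : EuclideanSpace ℝ (Fin k)} (hθ : θ ∈ Θ) :
    IsProbabilityMeasure (expLaw μ p₀ g φ θ) :=
  ⟨by rw [expLaw, withDensity_apply _ MeasurableSet.univ, setLIntegral_univ,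
    hfam.lintegral_expDensity hθ]⟩

/-- The tilted density is again a member of the family, of total mass one, so the moment generating
function is a ratio of normalizing constants. -/
theorem lintegral_exp_inner {θ h : EuclideanSpace ℝ (Fin k)} (hθ : θ + h ∈ Θ) :
    ∫⁻ y, ENNReal.ofReal (Real.exp (inner ℝ h (suffStat g y))) ∂(expLaw μ p₀ g φ θ)
      = ENNReal.ofReal (Real.exp (φ (θ + h) - φ θ)) := by
  have h2 := hfam.measurable_suffStat
  rw [expLaw, lintegral_withDensity_eq_lintegral_mul _ (hfam.measurable_expDensity θ)
    (by fun_prop)]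
  have hpt : ∀ y, (expDensity p₀ g φ θ
      * fun y => ENNReal.ofReal (Real.exp (inner ℝ h (suffStat g y)))) y
      = expDensity p₀ g φ (θ + h) y * ENNReal.ofReal (Real.exp (φ (θ + h) - φ θ)) := by
    intro y
    rw [Pi.mul_apply, expDensity_add, mul_assoc, ← ENNReal.ofReal_mul (Real.exp_pos _).le,
      ← Real.exp_add, sub_add_cancel]
  simp_rw [hpt]
  rw [lintegral_mul_const _ (hfam.measurable_expDensity _), hfam.lintegral_expDensity hθ, one_mul]

theorem integrable_exp_inner {θ h : EuclideanSpace ℝ (Fin k)} (hθ : θ + h ∈ Θ) :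
    Integrable (fun y => Real.exp (inner ℝ h (suffStat g y))) (expLaw μ p₀ g φ θ) := by
  have h2 := hfam.measurable_suffStat
  rw [← lintegral_ofReal_ne_top_iff_integrable (by fun_prop)
    (Eventually.of_forall fun _ => (Real.exp_pos _).le), hfam.lintegral_exp_inner hθ]
  exact ENNReal.ofReal_ne_top

theorem integral_exp_inner {θ h : EuclideanSpace ℝ (Fin k)} (hθ : θ + h ∈ Θ) :
    ∫ y, Real.exp (inner ℝ h (suffStat g y)) ∂(expLaw μ p₀ g φ θ)
      = Real.exp (φ (θ + h) - φ θ) := by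
  have h2 := hfam.measurable_suffStat
  rw [integral_eq_lintegral_of_nonneg_ae (Eventually.of_forall fun _ => (Real.exp_pos _).le)
    (by fun_prop), hfam.lintegral_exp_inner hθ, ENNReal.toReal_ofReal (Real.exp_pos _).le]

omit hfam in
theorem eventually_add_smul_mem {θ : EuclideanSpace ℝ (Fin k)} (hθ : θ ∈ interior Θ)
    (v : EuclideanSpace ℝ (Fin k)) : ∀ᶠ t : ℝ in 𝓝 0, θ + t • v ∈ interior Θ := by
  have : ContinuousAt (fun t : ℝ => θ + t • v) 0 := by fun_prop
  exact this.eventually_mem (by simpa using isOpen_interior.mem_nhds hθ)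

theorem zero_mem_interior_integrableExpSet {θ : EuclideanSpace ℝ (Fin k)} (hθ : θ ∈ interior Θ)
    (v : EuclideanSpace ℝ (Fin k)) :
    0 ∈ interior (integrableExpSet (fun y => inner ℝ v (suffStat g y)) (expLaw μ p₀ g φ θ)) := by
  rw [mem_interior_iff_mem_nhds]
  filter_upwards [eventually_add_smul_mem hθ v] with t ht
  have := hfam.integrable_exp_inner (interior_subset ht)
  simpa [integrableExpSet, inner_smul_left] using this

/-- This turns derivatives of `φ` along lines into cumulants: mean from the gradient, variance from
the Hessian. -/
theorem cgf_eventuallyEq {θ : EuclideanSpace ℝ (Fin k)} (hθ : θ ∈ interior Θ)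
    (v : EuclideanSpace ℝ (Fin k)) :
    cgf (fun y => inner ℝ v (suffStat g y)) (expLaw μ p₀ g φ θ)
      =ᶠ[𝓝 0] fun t => φ (θ + t • v) - φ θ := by
  filter_upwards [eventually_add_smul_mem hθ v] with t ht
  have := hfam.integral_exp_inner (interior_subset ht)
  simp only [inner_smul_left, conj_trivial] at this
  rw [cgf, mgf, this, Real.log_exp]

theorem contDiffOn_interior : ContDiffOn ℝ 2 φ (interior Θ) :=
  hfam.contDiffOn_potential.mono interior_subset

theorem integral_inner_suffStat {θ : EuclideanSpace ℝ (Fin k)} (hθ : θ ∈ interior Θ)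
    (v : EuclideanSpace ℝ (Fin k)) :
    ∫ y, inner ℝ v (suffStat g y) ∂(expLaw μ p₀ g φ θ) = fderiv ℝ φ θ v := by
  have := hfam.isProbabilityMeasure_expLaw (interior_subset hθ)
  have h1 := deriv_cgf_zero (hfam.zero_mem_interior_integrableExpSet hθ v)
  have h2 : HasDerivAt (fun t : ℝ => φ (θ + t • v) - φ θ) (fderiv ℝ φ θ v) 0 := by
    simpa using (hasDerivAt_comp_line (h := v) (t := 0) isOpen_interior hfam.contDiffOn_interior
      (by simpa using hθ)).sub_const (φ θ)
  rw [(hfam.cgf_eventuallyEq hθ v).deriv_eq, h2.deriv] at h1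
  simpa using h1.symm

theorem integral_sq_inner_suffStat_sub {θ : EuclideanSpace ℝ (Fin k)} (hθ : θ ∈ interior Θ)
    (v : EuclideanSpace ℝ (Fin k)) :
    ∫ y, (inner ℝ v (suffStat g y - gradient φ θ)) ^ 2 ∂(expLaw μ p₀ g φ θ)
      = fderiv ℝ (fderiv ℝ φ) θ v v := by
  have := hfam.isProbabilityMeasure_expLaw (interior_subset hθ)
  have h0 := hfam.zero_mem_interior_integrableExpSet hθ v
  have h1 := iteratedDeriv_two_cgf_eq_integral h0
  have h2 : HasDerivAt (fun t : ℝ => fderiv ℝ φ (θ + t • v) v)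
      (fderiv ℝ (fderiv ℝ φ) θ v v) 0 := by
    simpa using hasDerivAt_fderiv_comp_line (h := v) (t := 0) isOpen_interior
      hfam.contDiffOn_interior (by simpa using hθ)
  -- The first derivative is identified on a whole neighbourhood of `0`, since it is differentiated
  -- once more.
  have h3 : deriv (cgf (fun y => inner ℝ v (suffStat g y)) (expLaw μ p₀ g φ θ))
      =ᶠ[𝓝 0] fun t => fderiv ℝ φ (θ + t • v) v := by
    filter_upwards [(hfam.cgf_eventuallyEq hθ v).deriv, eventually_add_smul_mem hθ v] with t ht hm
    rw [ht]
    exact ((hasDerivAt_comp_line isOpen_interior hfam.contDiffOn_interior hm).sub_const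
      (φ θ)).deriv
  have h4 : ∀ y, inner ℝ v (suffStat g y - gradient φ θ)
      = inner ℝ v (suffStat g y) - fderiv ℝ φ θ v := by
    intro y
    rw [inner_sub_right, real_inner_comm (gradient φ θ), gradient,
      InnerProductSpace.toDual_symm_apply]
  rw [iteratedDeriv_succ, iteratedDeriv_one, h3.deriv_eq, h2.deriv, h3.eq_of_nhds] at h1
  simp_rw [h4]
  simpa using h1.symm

theorem integral_inner_suffStat_sub {θ : EuclideanSpace ℝ (Fin k)} (hθ : θ ∈ interior Θ)
    (v : EuclideanSpace ℝ (Fin k)) :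
    ∫ y, inner ℝ v (suffStat g y - gradient φ θ) ∂(expLaw μ p₀ g φ θ) = 0 := by
  have := hfam.isProbabilityMeasure_expLaw (interior_subset hθ)
  have hint : Integrable (fun y => inner ℝ v (suffStat g y)) (expLaw μ p₀ g φ θ) := by
    simpa using integrable_pow_of_mem_interior_integrableExpSet
      (hfam.zero_mem_interior_integrableExpSet hθ v) 1
  simp_rw [inner_sub_right]
  rw [integral_sub hint (integrable_const _), hfam.integral_inner_suffStat hθ, real_inner_comm,
    gradient, InnerProductSpace.toDual_symm_apply]
  simp

theorem measurable_score (θ : EuclideanSpace ℝ (Fin k)) (n : ℕ) : Measurable (score g φ θ n) := by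
  have h2 := hfam.measurable_suffStat
  unfold score
  fun_prop

/-- The projection of the score on `v` is a normalized sum of independent copies, so the
characteristic function factors; this reduces the vector limit theorem to dimension one. -/
theorem charFun_map_score {θ : EuclideanSpace ℝ (Fin k)} (hθ : θ ∈ interior Θ) (n : ℕ)
    (v : EuclideanSpace ℝ (Fin k)) :
    charFun ((Measure.pi fun _ : Fin n => expLaw μ p₀ g φ θ).map (score g φ θ n)) v
      = charFun ((expLaw μ p₀ g φ θ).map fun y => inner ℝ v (suffStat g y - gradient φ θ))
          (√n)⁻¹ ^ n := by
  have := hfam.isProbabilityMeasure_expLaw (interior_subset hθ)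
  have h2 := hfam.measurable_suffStat
  rw [charFun_apply, integral_map (hfam.measurable_score θ n).aemeasurable (by fun_prop),
    charFun_apply_real, integral_map (by fun_prop) (by fun_prop)]
  have hpow := integral_fintype_prod_eq_pow (𝕜 := ℂ) (ι := Fin n) (μ := expLaw μ p₀ g φ θ)
    (fun y => Complex.exp ((√n : ℝ)⁻¹ * (inner ℝ v (suffStat g y - gradient φ θ) : ℝ) * Complex.I))
  rw [Fintype.card_fin] at hpow
  push_cast at hpow ⊢
  rw [← hpow]
  refine integral_congr_ae (Eventually.of_forall fun y => ?_)
  simp only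
  rw [← Complex.exp_sum, score, real_inner_comm, inner_smul_right, inner_sum, ← Finset.sum_mul,
    ← Finset.mul_sum]
  push_cast
  rfl

/-- The projection has variance `σ² = φ''(θ)(v, v)`. Standardize by `σ > 0` and apply the scalar
limit theorem at the argument `σ`. -/
theorem tendsto_charFun_map_score {θ : EuclideanSpace ℝ (Fin k)} (hθ : θ ∈ interior Θ)
    {v : EuclideanSpace ℝ (Fin k)} (hv : 0 < fderiv ℝ (fderiv ℝ φ) θ v v) :
    Tendsto (fun n : ℕ => charFun
        ((Measure.pi fun _ : Fin n => expLaw μ p₀ g φ θ).map (score g φ θ n)) v) atTop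
      (𝓝 (Complex.exp (-(fderiv ℝ (fderiv ℝ φ) θ v v : ℝ) / 2))) := by
  have := hfam.isProbabilityMeasure_expLaw (interior_subset hθ)
  have h2 := hfam.measurable_suffStat
  set σ := √(fderiv ℝ (fderiv ℝ φ) θ v v)
  have hσ : 0 < σ := Real.sqrt_pos.2 hv
  have hσ2 : σ ^ 2 = fderiv ℝ (fderiv ℝ φ) θ v v := Real.sq_sqrt hv.le
  have hclt := tendsto_charFun_inv_sqrt_mul_pow (P := expLaw μ p₀ g φ θ)
    (X := fun y => σ⁻¹ * inner ℝ v (suffStat g y - gradient φ θ)) (by fun_prop)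
    (by rw [integral_const_mul, hfam.integral_inner_suffStat_sub hθ, mul_zero])
    (by
      simp only [Pi.pow_apply, mul_pow]
      rw [integral_const_mul, hfam.integral_sq_inner_suffStat_sub hθ, ← hσ2]
      field_simp) σ
  have hX : (fun n : ℕ => charFun ((expLaw μ p₀ g φ θ).map
      fun y => σ⁻¹ * inner ℝ v (suffStat g y - gradient φ θ)) ((√n)⁻¹ * σ) ^ n)
      = fun n : ℕ => charFun
        ((Measure.pi fun _ : Fin n => expLaw μ p₀ g φ θ).map (score g φ θ n)) v := by
    funext n
    rw [hfam.charFun_map_score hθ, charFun_map_mul_comp (by fun_prop)]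
    congr 2
    field_simp
  rw [hX] at hclt
  convert! hclt using 3
  rw [← hσ2]
  push_cast
  rfl

end IsExponentialFamily

end Family

/-! ### Square root of the Hessian, the central limit theorem and the Gaussian limit. -/

section CLT

open ProbabilityTheory
open scoped MatrixOrder

variable {k : ℕ} {Y : Type*} [MeasurableSpace Y] {μ : Measure Y}
  {p₀ : Y → ℝ≥0} {g : Fin k → Y → ℝ} {φ : EuclideanSpace ℝ (Fin k) → ℝ}
  {Θ : Set (EuclideanSpace ℝ (Fin k))}

/-- At an interior point the Hessian is the square of a symmetric operator. -/
theorem IsExponentialFamily.exists_sqrt_hessian (hfam : IsExponentialFamily μ p₀ g φ Θ)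
    {θ : EuclideanSpace ℝ (Fin k)} (hθ : θ ∈ interior Θ) :
    ∃ A : EuclideanSpace ℝ (Fin k) →L[ℝ] EuclideanSpace ℝ (Fin k),
      (A : EuclideanSpace ℝ (Fin k) →ₗ[ℝ] EuclideanSpace ℝ (Fin k)).IsSymmetric ∧
      (∀ v, ‖A v‖ ^ 2 = fderiv ℝ (fderiv ℝ φ) θ v v) ∧
      LinearMap.det (A : EuclideanSpace ℝ (Fin k) →ₗ[ℝ] EuclideanSpace ℝ (Fin k)) ^ 2
        = (fisherInfo φ θ).det := by
  have hcd : ContDiffAt ℝ 2 φ θ :=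
    hfam.contDiffOn_interior.contDiffAt (isOpen_interior.mem_nhds hθ)
  have hd : DifferentiableAt ℝ (fderiv ℝ φ) θ :=
    (hcd.fderiv_right (m := 1) (by norm_num)).differentiableAt (by simp)
  have hsymm : IsSymmSndFDerivAt ℝ φ θ := hcd.isSymmSndFDerivAt (by simp)
  have hJ : ∀ i j, fisherInfo φ θ i j
      = fderiv ℝ (fderiv ℝ φ) θ (EuclideanSpace.single i 1) (EuclideanSpace.single j 1) := by
    intro i j
    have h1 : HasFDerivAt (fun η => fderiv ℝ φ η (EuclideanSpace.single j 1))
        ((fderiv ℝ (fderiv ℝ φ) θ).flip (EuclideanSpace.single j 1)) θ := by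
      have := hd.hasFDerivAt.clm_apply (hasFDerivAt_const (EuclideanSpace.single j (1 : ℝ)) θ)
      simpa using this
    rw [fisherInfo, Matrix.of_apply, h1.fderiv]
    rfl
  have hquad : ∀ v : EuclideanSpace ℝ (Fin k),
      v.ofLp ⬝ᵥ (fisherInfo φ θ).mulVec v.ofLp = fderiv ℝ (fderiv ℝ φ) θ v v := by
    intro v
    have hv : v = ∑ i, v i • EuclideanSpace.single i (1 : ℝ) := by
      simpa using ((EuclideanSpace.basisFun (Fin k) ℝ).sum_repr v).symm
    conv_rhs => rw [hv]
    simp only [map_sum, map_smul, sum_apply, smul_apply,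
      smul_eq_mul, dotProduct, Matrix.mulVec, hJ, Finset.mul_sum]
    rw [Finset.sum_comm]
    refine Finset.sum_congr rfl fun i _ => Finset.sum_congr rfl fun j _ => ?_
    ring
  -- The quadratic form of the Hessian is the integral of a square, by the variance identity.
  have hpsd : (fisherInfo φ θ).PosSemidef := by
    refine Matrix.PosSemidef.of_dotProduct_mulVec_nonneg ?_ fun x => ?_
    · ext i j
      simp [hJ, hsymm.eq (EuclideanSpace.single j 1) (EuclideanSpace.single i 1)]
    · have h1 := hquad (WithLp.toLp 2 x)
      have h2 := hfam.integral_sq_inner_suffStat_sub hθ (WithLp.toLp 2 x)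
      rw [star_trivial]
      refine le_of_le_of_eq ?_ h1.symm
      rw [← h2]
      exact integral_nonneg fun _ => sq_nonneg _
  have hsq : CFC.sqrt (fisherInfo φ θ) * CFC.sqrt (fisherInfo φ θ) = fisherInfo φ θ :=
    CFC.sqrt_mul_sqrt_self _ hpsd.nonneg
  have hsa : IsSelfAdjoint (Matrix.toEuclideanCLM (𝕜 := ℝ) (CFC.sqrt (fisherInfo φ θ))) :=
    (CFC.sqrt_nonneg _).isSelfAdjoint.map _
  refine ⟨Matrix.toEuclideanCLM (𝕜 := ℝ) (CFC.sqrt (fisherInfo φ θ)),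
    ContinuousLinearMap.isSelfAdjoint_iff_isSymmetric.1 hsa, fun v => ?_, ?_⟩
  · rw [← hquad v, ← Matrix.inner_toEuclideanCLM, ← real_inner_self_eq_norm_sq]
    conv_rhs => rw [← hsq, map_mul, mul_apply_eq_comp]
    exact ContinuousLinearMap.isSelfAdjoint_iff_isSymmetric.1 hsa _ _
  · have hdet : LinearMap.det ((Matrix.toEuclideanCLM (𝕜 := ℝ) (CFC.sqrt (fisherInfo φ θ))
        : EuclideanSpace ℝ (Fin k) →L[ℝ] EuclideanSpace ℝ (Fin k)) :
        EuclideanSpace ℝ (Fin k) →ₗ[ℝ] EuclideanSpace ℝ (Fin k))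
        = (CFC.sqrt (fisherInfo φ θ)).det := by
      rw [Matrix.coe_toEuclideanCLM_eq_toEuclideanLin]
      exact (congrArg (fun f => LinearMap.det (f (CFC.sqrt (fisherInfo φ θ))))
        (Matrix.toLpLin_eq_toLin (R := ℝ) (m := Fin k) (n := Fin k) 2 2)).trans
        (LinearMap.det_toLin _ _)
    rw [hdet, sq, ← Matrix.det_mul, hsq]

/-- The central limit theorem for the normalized statistic. -/
theorem IsExponentialFamily.tendsto_integral_score (hfam : IsExponentialFamily μ p₀ g φ Θ)
    {θ : EuclideanSpace ℝ (Fin k)} (hθ : θ ∈ interior Θ)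
    {A : EuclideanSpace ℝ (Fin k) →L[ℝ] EuclideanSpace ℝ (Fin k)}
    (hsymm : (A : EuclideanSpace ℝ (Fin k) →ₗ[ℝ] EuclideanSpace ℝ (Fin k)).IsSymmetric)
    (hA : ∀ v, ‖A v‖ ^ 2 = fderiv ℝ (fderiv ℝ φ) θ v v)
    (hdet : LinearMap.det (A : EuclideanSpace ℝ (Fin k) →ₗ[ℝ] EuclideanSpace ℝ (Fin k)) ≠ 0)
    {f : EuclideanSpace ℝ (Fin k) → ℝ} (hf : Continuous f) {C : ℝ} (hC : ∀ x, ‖f x‖ ≤ C) :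
    Tendsto (fun n : ℕ => ∫ y, f (score g φ θ n y) ∂(Measure.pi fun _ : Fin n => expLaw μ p₀ g φ θ))
      atTop (𝓝 (∫ ξ, f (A ξ) ∂(stdGaussian (EuclideanSpace ℝ (Fin k))))) := by
  have := hfam.isProbabilityMeasure_expLaw (interior_subset hθ)
  let P : ℕ → ProbabilityMeasure (EuclideanSpace ℝ (Fin k)) := fun n =>
    ⟨(Measure.pi fun _ : Fin n => expLaw μ p₀ g φ θ).map (score g φ θ n),
      Measure.isProbabilityMeasure_map (hfam.measurable_score θ n).aemeasurable⟩
  let Q : ProbabilityMeasure (EuclideanSpace ℝ (Fin k)) :=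
    ⟨(stdGaussian (EuclideanSpace ℝ (Fin k))).map A,
      Measure.isProbabilityMeasure_map (by fun_prop)⟩
  have hinj : ∀ v, v ≠ 0 → A v ≠ 0 := by
    intro v hv h0
    have h1 : IsUnit (A : EuclideanSpace ℝ (Fin k) →ₗ[ℝ] EuclideanSpace ℝ (Fin k)) :=
      (LinearMap.isUnit_iff_isUnit_det _).2 (isUnit_iff_ne_zero.2 hdet)
    have h2 := ((Module.End.isUnit_iff _).1 h1).injective
    exact hv (h2 (by simpa using h0))
  have hconv : Tendsto P atTop (𝓝 Q) := by
    refine ProbabilityMeasure.tendsto_of_tendsto_charFun fun v => ?_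
    -- At `v = 0` the variance vanishes and standardization fails, but both characteristic functions
    -- equal `1`. Elsewhere injectivity of `A` makes the variance positive.
    rcases eq_or_ne v 0 with rfl | hv
    · simp
    have hQ : charFun (Q : Measure (EuclideanSpace ℝ (Fin k))) v
        = Complex.exp (-(fderiv ℝ (fderiv ℝ φ) θ v v : ℝ) / 2) := by
      have h1 : charFun (Q : Measure (EuclideanSpace ℝ (Fin k))) v
          = charFun (stdGaussian (EuclideanSpace ℝ (Fin k))) (A v) := by
        rw [charFun_apply, charFun_apply]
        change ∫ x, _ ∂((stdGaussian (EuclideanSpace ℝ (Fin k))).map A) = _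
        rw [integral_map (by fun_prop) (by fun_prop)]
        refine integral_congr_ae (Eventually.of_forall fun x => ?_)
        have := hsymm x v
        simp only [ContinuousLinearMap.coe_coe] at this
        simp only [this]
      rw [h1, charFun_stdGaussian, ← hA]
      push_cast
      rfl
    rw [hQ]
    refine hfam.tendsto_charFun_map_score hθ ?_
    rw [← hA]
    have := norm_pos_iff.2 (hinj v hv)
    positivity
  have h := ProbabilityMeasure.tendsto_iff_forall_integral_tendsto.1 hconv
    (BoundedContinuousFunction.ofNormedAddCommGroup f hf C hC)
  simp only [BoundedContinuousFunction.coe_ofNormedAddCommGroup] at h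
  have hQ : ∫ x, f x ∂(Q : Measure (EuclideanSpace ℝ (Fin k)))
      = ∫ ξ, f (A ξ) ∂(stdGaussian (EuclideanSpace ℝ (Fin k))) :=
    integral_map (by fun_prop) hf.aestronglyMeasurable
  have hP : ∀ n, ∫ x, f x ∂(P n : Measure (EuclideanSpace ℝ (Fin k)))
      = ∫ y, f (score g φ θ n y) ∂(Measure.pi fun _ : Fin n => expLaw μ p₀ g φ θ) := fun n =>
    integral_map (hfam.measurable_score θ n).aemeasurable hf.aestronglyMeasurable
  simpa only [hQ, hP] using h

theorem continuous_gaussWindow_rpow {E : Type*} [NormedAddCommGroup E] [InnerProductSpace ℝ E]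
    [FiniteDimensional ℝ E] [MeasurableSpace E] [BorelSpace E] (A : E →L[ℝ] E) {M : ℝ}
    (hM : 0 < M) (s : ℝ) : Continuous fun x => gaussWindow A M x ^ (-s) :=
  (continuous_gaussWindow A M).rpow_const fun x => Or.inl (gaussWindow_pos A hM x).ne'

/-- One bound for all larger radii: with `M' = M` it gives the boundedness that weak convergence
needs, with `M = 1` a dominating constant as the radius grows. -/
theorem gaussWindow_rpow_le {E : Type*} [NormedAddCommGroup E] [InnerProductSpace ℝ E]
    [FiniteDimensional ℝ E] [MeasurableSpace E] [BorelSpace E] (A : E →L[ℝ] E) {M M' s : ℝ}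
    (hM : 0 < M) (hM' : M ≤ M') (hs : 0 ≤ s) (x : E) :
    ‖gaussWindow A M' x ^ (-s)‖ ≤ gaussWindow A M 0 ^ (-s) := by
  rw [Real.norm_of_nonneg (Real.rpow_nonneg (gaussWindow_pos A (hM.trans_le hM') x).le _)]
  exact Real.rpow_le_rpow_of_nonpos (gaussWindow_zero_pos A hM)
    ((gaussWindow_mono A hM' 0).trans (gaussWindow_zero_le A M' x)) (neg_nonpos.2 hs)

/-- The limit, as the truncation is removed, of the Gaussian expectation of `gaussWindow ^ (-s)`. -/
theorem tendsto_integral_gaussWindow_rpow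
    {A : EuclideanSpace ℝ (Fin k) →L[ℝ] EuclideanSpace ℝ (Fin k)}
    (hsymm : (A : EuclideanSpace ℝ (Fin k) →ₗ[ℝ] EuclideanSpace ℝ (Fin k)).IsSymmetric)
    (hdet : LinearMap.det (A : EuclideanSpace ℝ (Fin k) →ₗ[ℝ] EuclideanSpace ℝ (Fin k)) ≠ 0)
    {s : ℝ} (hs : 0 < s) :
    Tendsto (fun m : ℕ => ∫ ξ, gaussWindow A m (A ξ) ^ (-s)
        ∂(stdGaussian (EuclideanSpace ℝ (Fin k)))) atTop
      (𝓝 ((|(LinearMap.det (A : EuclideanSpace ℝ (Fin k) →ₗ[ℝ] EuclideanSpace ℝ (Fin k)))⁻¹|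
        * (2 * Real.pi) ^ (k / 2 : ℝ)) ^ (-s) * (1 + s) ^ (-(k / 2) : ℝ))) := by
  set D := |(LinearMap.det (A : EuclideanSpace ℝ (Fin k) →ₗ[ℝ] EuclideanSpace ℝ (Fin k)))⁻¹|
  have hD : 0 < D := abs_pos.2 (inv_ne_zero hdet)
  rw [← integral_stdGaussian_exp_neg_mul_sq k hs, ← integral_const_mul]
  refine tendsto_integral_filter_of_dominated_convergence
    (fun _ => gaussWindow A 1 0 ^ (-s)) ?_ ?_ (integrable_const _) ?_
  · filter_upwards [eventually_gt_atTop 0] with m hm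
    exact ((continuous_gaussWindow_rpow A (by exact_mod_cast hm) s).comp
      A.continuous).aestronglyMeasurable
  · filter_upwards [eventually_ge_atTop 1] with m hm
    exact Eventually.of_forall fun ξ =>
      gaussWindow_rpow_le A one_pos (by exact_mod_cast hm) hs.le _
  · refine Eventually.of_forall fun ξ => ?_
    have h := tendsto_gaussWindow hdet hsymm ξ
    rw [finrank_euclideanSpace_fin] at h
    have h2 := h.rpow_const (p := -s) (Or.inl (by positivity))
    convert! h2 using 2
    rw [← mul_assoc, Real.mul_rpow (by positivity) (Real.exp_pos _).le, ← Real.exp_mul]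
    congr 2
    ring

end CLT

/-! ### Assembling the redundancy bounds. -/

section Redundancy

variable {k : ℕ} {Y : Type*} [MeasurableSpace Y] {μ : Measure Y} [SigmaFinite μ]
  {p₀ : Y → ℝ≥0} {g : Fin k → Y → ℝ} {φ : EuclideanSpace ℝ (Fin k) → ℝ}
  {Θ : Set (EuclideanSpace ℝ (Fin k))} {w : EuclideanSpace ℝ (Fin k) → ℝ}

/-- The Rényi redundancy is bounded through the expectation of a power of a truncated Gaussian
integral. -/
theorem IsExponentialFamily.renyiRedundancy_le (hfam : IsExponentialFamily μ p₀ g φ Θ)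
    {θ : EuclideanSpace ℝ (Fin k)} (hθ : θ ∈ Θ)
    {A : EuclideanSpace ℝ (Fin k) →L[ℝ] EuclideanSpace ℝ (Fin k)}
    {n : ℕ} (hn : 0 < n) {s M w₁ ε V : ℝ} (hs : 0 < s) (hM : 0 < M) (hw₁ : 0 < w₁)
    (hmem : ∀ u, ‖u‖ ≤ M → θ + (√n)⁻¹ • u ∈ Θ ∧ w₁ ≤ w (θ + (√n)⁻¹ • u) ∧
      n * (φ (θ + (√n)⁻¹ • u) - φ θ - fderiv ℝ φ θ ((√n)⁻¹ • u)) ≤ ‖A u‖ ^ 2 / 2 + ε)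
    (hV : 0 < V)
    (hint : ∫ y, gaussWindow A M (score g φ θ n y) ^ (-s)
      ∂(Measure.pi fun _ : Fin n => expLaw μ p₀ g φ θ) ≤ V) :
    renyiRedundancy μ p₀ g φ Θ w s n θ
      ≤ ((k / 2 * Real.log n - Real.log w₁ + ε + s⁻¹ * Real.log V : ℝ) : EReal) := by
  have := hfam.isProbabilityMeasure_expLaw hθ
  have hn' : (0 : ℝ) < n := by exact_mod_cast hn
  set a : ℝ := (n : ℝ) ^ (-(k / 2) : ℝ) * (w₁ * Real.exp (-ε)) with ha
  have ha0 : 0 < a := by positivity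
  have hloga : Real.log a = -(k / 2) * Real.log n + (Real.log w₁ - ε) := by
    rw [ha, Real.log_mul (by positivity) (by positivity), Real.log_rpow hn',
      Real.log_mul (by positivity) (by positivity), Real.log_exp]
    ring
  have hW : ∀ y : Fin n → Y, 0 < gaussWindow A M (score g φ θ n y) := fun y =>
    gaussWindow_pos A hM _
  have hmeas : Measurable fun y : Fin n → Y => gaussWindow A M (score g φ θ n y) ^ (-s) :=
    (continuous_gaussWindow_rpow A hM s).measurable.comp (hfam.measurable_score θ n)
  have hB : 0 < a ^ (-s) * V := by positivity
  have hintegrable : Integrable (fun y : Fin n → Y => gaussWindow A M (score g φ θ n y) ^ (-s))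
      (Measure.pi fun _ : Fin n => expLaw μ p₀ g φ θ) :=
    Integrable.of_bound hmeas.aestronglyMeasurable (gaussWindow A M 0 ^ (-s))
      (Eventually.of_forall fun y => gaussWindow_rpow_le A hM le_rfl hs.le _)
  have hmain : renyiRedundancy μ p₀ g φ Θ w s n θ
      ≤ ((s⁻¹ * Real.log (a ^ (-s) * V) : ℝ) : EReal) := by
    refine renyiDiv_le_of_mul_le _ hs hB (c := fun y => a * gaussWindow A M (score g φ θ n y))
      (fun y => mul_pos ha0 (hW y))
      (mul_gaussWindow_le_mixtureDensity p₀ g φ hfam.measurableSet_param hn hw₁.le hmem) ?_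
    simp_rw [fun y => Real.mul_rpow (z := -s) ha0.le (hW y).le,
      ENNReal.ofReal_mul (Real.rpow_nonneg ha0.le (-s))]
    rw [lintegral_iidDensity_mul (hfam.measurable_expDensity θ) (expDensity_ne_top p₀ g φ θ)
      (by rw [hfam.lintegral_expDensity hθ]; exact ENNReal.one_ne_top) n (by fun_prop),
      lintegral_const_mul _ (by fun_prop)]
    gcongr
    change ∫⁻ y, _ ∂(Measure.pi fun _ : Fin n => expLaw μ p₀ g φ θ) ≤ _
    rw [← ofReal_integral_eq_lintegral_ofReal hintegrable
      (Eventually.of_forall fun y => Real.rpow_nonneg (hW y).le _)]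
    exact ENNReal.ofReal_le_ofReal hint
  refine hmain.trans (le_of_eq ?_)
  rw [Real.log_mul (by positivity) hV.ne', Real.log_rpow ha0, hloga]
  congr 1
  field_simp
  ring

/-- The uniform bound for the order `1 + n`. -/
theorem IsExponentialFamily.exists_forall_renyiRedundancy_le
    (hfam : IsExponentialFamily μ p₀ g φ Θ) (hcont : ContinuousOn w Θ)
    {K : Set (EuclideanSpace ℝ (Fin k))} (hK : IsCompact K) (hKΘ : K ⊆ interior Θ)
    (hKw : ∀ θ ∈ K, 0 < w θ) :
    ∃ C : ℝ, ∀ n : ℕ, 0 < n → ∀ s : ℝ, 0 < s → ∀ θ ∈ K,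
      renyiRedundancy μ p₀ g φ Θ w s n θ ≤ ((k / 2 * Real.log n + C : ℝ) : EReal) := by
  have hw' : ContinuousOn w (interior Θ) := hcont.mono interior_subset
  have hopen : IsOpen (interior Θ ∩ w ⁻¹' Set.Ioi 0) :=
    hw'.isOpen_inter_preimage isOpen_interior isOpen_Ioi
  obtain ⟨δ₁, hδ₁, hsub⟩ := hK.exists_cthickening_subset_open hopen
    fun θ hθ => ⟨hKΘ hθ, hKw θ hθ⟩
  obtain ⟨w₁, hw₁, hle⟩ := hK.cthickening.exists_forall_le' (f := w) (a := 0)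
    (hw'.mono fun θ hθ => (hsub hθ).1) fun θ hθ => (hsub hθ).2
  obtain ⟨δ₂, hδ₂, C, hC, hquad⟩ :=
    exists_quadratic_upper_bound isOpen_interior hfam.contDiffOn_interior hK hKΘ
  -- A fixed radius works for every `n ≥ 1`, because `1/√n ≤ 1`.
  set M := min δ₁ δ₂
  have hM : 0 < M := lt_min hδ₁ hδ₂
  -- A scalar operator with `‖A u‖² = C ‖u‖²` matches the crude Taylor bound exactly, so `ε = 0`
  -- suffices and the Hessian may be singular.
  set A : EuclideanSpace ℝ (Fin k) →L[ℝ] EuclideanSpace ℝ (Fin k) :=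
    √C • ContinuousLinearMap.id ℝ _ with hAdef
  have hA : ∀ u, ‖A u‖ ^ 2 = C * ‖u‖ ^ 2 := by
    intro u
    rw [hAdef, smul_apply, ContinuousLinearMap.id_apply, norm_smul, mul_pow,
      Real.norm_of_nonneg (Real.sqrt_nonneg _), Real.sq_sqrt hC.le]
  have hW := gaussWindow_zero_pos A hM
  -- With `V = W(0)^{-s}` the term `s⁻¹ log V` is `-log W(0)`, free of `s`; this is what allows the
  -- choice `s = n`.
  refine ⟨-Real.log w₁ - Real.log (gaussWindow A M 0), fun n hn s hs θ hθ => ?_⟩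
  have hn' : (0 : ℝ) < n := by exact_mod_cast hn
  have := hfam.isProbabilityMeasure_expLaw (interior_subset (hKΘ hθ))
  refine (hfam.renyiRedundancy_le (A := A) (ε := 0) (V := gaussWindow A M 0 ^ (-s))
    (interior_subset (hKΘ hθ)) hn hs hM hw₁ (fun u hu => ?_) (by positivity) ?_).trans
    (le_of_eq ?_)
  · have hnorm : ‖(√n : ℝ)⁻¹ • u‖ ≤ M := by
      rw [norm_smul, norm_inv, Real.norm_of_nonneg (Real.sqrt_nonneg _)]
      refine (mul_le_of_le_one_left (norm_nonneg _) (inv_le_one_of_one_le₀ ?_)).trans hu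
      exact Real.one_le_sqrt.2 (by exact_mod_cast hn)
    obtain ⟨h1, h2⟩ := hquad θ hθ _ (hnorm.trans (min_le_right _ _))
    refine ⟨interior_subset h1, hle _ ?_, ?_⟩
    · exact Metric.mem_cthickening_of_dist_le _ θ _ _ hθ
        (by simpa [dist_eq_norm] using hnorm.trans (min_le_left _ _))
    · rw [hA, add_zero]
      calc n * (φ (θ + (√n)⁻¹ • u) - φ θ - fderiv ℝ φ θ ((√n)⁻¹ • u))
          ≤ n * (C * ‖(√n : ℝ)⁻¹ • u‖ ^ 2 / 2) := by gcongr; linarith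
        _ = C * ‖u‖ ^ 2 / 2 := by
          rw [norm_smul, norm_inv, Real.norm_of_nonneg (Real.sqrt_nonneg _), mul_pow, inv_pow,
            Real.sq_sqrt hn'.le]
          field_simp
  · refine (Real.le_norm_self _).trans ((norm_integral_le_of_norm_le_const
      (Eventually.of_forall fun y => gaussWindow_rpow_le A hM le_rfl hs.le _)).trans ?_)
    simp
  · rw [Real.log_rpow hW]
    congr 1
    field_simp
    ring

/-- The asymptotic bound for a fixed order `1 + s`, up to an arbitrary `ε > 0`. -/
theorem IsExponentialFamily.eventually_renyiRedundancy_le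
    (hfam : IsExponentialFamily μ p₀ g φ Θ) (hcont : ContinuousOn w Θ)
    {θ : EuclideanSpace ℝ (Fin k)} (hθ : θ ∈ interior Θ) (hwθ : 0 < w θ)
    (hJ : (fisherInfo φ θ).det ≠ 0) {s : ℝ} (hs : 0 < s) {ε : ℝ} (hε : 0 < ε) :
    ∀ᶠ n : ℕ in atTop, renyiRedundancy μ p₀ g φ Θ w s n θ
      ≤ ((k / 2 * Real.log (n / (2 * Real.pi)) + 1 / 2 * Real.log (fisherInfo φ θ).det
          + Real.log (1 / w θ) - k / (2 * s) * Real.log (1 + s) + ε : ℝ) : EReal) := by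
  obtain ⟨A, hsymm, hA, hdet2⟩ := hfam.exists_sqrt_hessian hθ
  set d := LinearMap.det (A : EuclideanSpace ℝ (Fin k) →ₗ[ℝ] EuclideanSpace ℝ (Fin k)) with hd
  have hd0 : d ≠ 0 := fun h => hJ (by rw [← hdet2, h]; simp)
  set V := (|d⁻¹| * (2 * Real.pi) ^ (k / 2 : ℝ)) ^ (-s) * (1 + s) ^ (-(k / 2) : ℝ) with hVdef
  have hV : 0 < V := by
    have := abs_pos.2 (inv_ne_zero hd0)
    positivity
  have hlogV : s⁻¹ * Real.log V = 1 / 2 * Real.log (fisherInfo φ θ).det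
      - k / 2 * Real.log (2 * Real.pi) - k / (2 * s) * Real.log (1 + s) := by
    have := abs_pos.2 (inv_ne_zero hd0)
    rw [hVdef, Real.log_mul (by positivity) (by positivity), Real.log_rpow (by positivity),
      Real.log_rpow (by positivity), Real.log_mul (by positivity) (by positivity), Real.log_abs,
      Real.log_inv, Real.log_rpow (by positivity), ← hdet2, Real.log_pow]
    push_cast
    field_simp
    ring
  -- The error splits into thirds: `s⁻¹ log exp(s ε/3)` here, the lower bound on `w` near `θ`, and
  -- the Taylor remainder.
  have hV' : V < V * Real.exp (s * (ε / 3)) :=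
    lt_mul_of_one_lt_right hV (Real.one_lt_exp_iff.2 (by positivity))
  -- The truncation radius `m` is fixed before `n` grows, so the limit theorem is applied to a
  -- single bounded function.
  obtain ⟨m, hm, hm0⟩ := (((tendsto_integral_gaussWindow_rpow hsymm hd0 hs).eventually_lt_const
    hV').and (eventually_gt_atTop 0)).exists
  have hM : (0 : ℝ) < m := by exact_mod_cast hm0
  have hclt := (hfam.tendsto_integral_score hθ hsymm hA hd0 (continuous_gaussWindow_rpow A hM s)
    (gaussWindow_rpow_le A hM le_rfl hs.le)).eventually_lt_const hm
  -- The tolerance is scaled by `2/m²` so that for `‖u‖ ≤ m` the halved remainder, after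
  -- multiplication by `n`, is at most `ε/3`.
  obtain ⟨δ₁, hδ₁, htaylor⟩ := eventually_second_order_upper_bound isOpen_interior
    hfam.contDiffOn_interior hθ (ε := 2 * (ε / 3) / m ^ 2) (by positivity)
  have hwcont : ContinuousAt w θ := hcont.continuousAt (mem_interior_iff_mem_nhds.1 hθ)
  have hw₁ : w θ * Real.exp (-(ε / 3)) < w θ :=
    mul_lt_of_lt_one_right hwθ (Real.exp_lt_one_iff.2 (by linarith))
  obtain ⟨δ₂, hδ₂, hw₂⟩ := Metric.nhds_basis_closedBall.eventually_iff.1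
    (hwcont.eventually (lt_mem_nhds hw₁))
  have hδ : 0 < min δ₁ δ₂ := lt_min hδ₁ hδ₂
  have hsmall : ∀ᶠ n : ℕ in atTop, (√(n : ℝ))⁻¹ * m < min δ₁ δ₂ := by
    have h1 : Tendsto (fun n : ℕ => (√(n : ℝ))⁻¹ * m) atTop (𝓝 (0 * m)) :=
      (tendsto_inv_atTop_zero.comp (Real.tendsto_sqrt_atTop.comp
        tendsto_natCast_atTop_atTop)).mul_const _
    rw [zero_mul] at h1
    exact h1.eventually_lt_const hδ
  filter_upwards [hclt, hsmall, eventually_gt_atTop 0] with n hn1 hn2 hn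
  have hn' : (0 : ℝ) < n := by exact_mod_cast hn
  refine (hfam.renyiRedundancy_le (A := A) (w₁ := w θ * Real.exp (-(ε / 3))) (ε := ε / 3)
    (interior_subset hθ) hn hs hM (by positivity)
    (fun u hu => ?_) (by positivity) hn1.le).trans (le_of_eq ?_)
  · have hnorm : ‖(√n : ℝ)⁻¹ • u‖ ≤ min δ₁ δ₂ := by
      rw [norm_smul, norm_inv, Real.norm_of_nonneg (Real.sqrt_nonneg _)]
      refine le_trans ?_ hn2.le
      gcongr
    obtain ⟨h1, h2⟩ := htaylor _ (hnorm.trans (min_le_left _ _))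
    refine ⟨interior_subset h1, (hw₂ ?_).le, ?_⟩
    · simpa using hnorm.trans (min_le_right _ _)
    · have hsq : (n : ℝ) * (√n)⁻¹ ^ 2 = 1 := by
        rw [inv_pow, Real.sq_sqrt hn'.le, mul_inv_cancel₀ hn'.ne']
      have h3 : 2 * (ε / 3) / (m : ℝ) ^ 2 * ‖u‖ ^ 2 ≤ 2 * (ε / 3) := by
        rw [div_mul_eq_mul_div, div_le_iff₀ (by positivity)]
        gcongr
      calc n * (φ (θ + (√n)⁻¹ • u) - φ θ - fderiv ℝ φ θ ((√n)⁻¹ • u))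
          ≤ n * ((fderiv ℝ (fderiv ℝ φ) θ ((√n)⁻¹ • u) ((√n)⁻¹ • u)
              + 2 * (ε / 3) / m ^ 2 * ‖(√n : ℝ)⁻¹ • u‖ ^ 2) / 2) := by gcongr; linarith
        _ = (n * (√n)⁻¹ ^ 2) * (‖A u‖ ^ 2 + 2 * (ε / 3) / m ^ 2 * ‖u‖ ^ 2) / 2 := by
          rw [← hA, map_smul, norm_smul, norm_smul, norm_inv,
            Real.norm_of_nonneg (Real.sqrt_nonneg _)]
          ring
        _ ≤ ‖A u‖ ^ 2 / 2 + ε / 3 := by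
          rw [hsq]
          linarith
  · rw [Real.log_mul hV.ne' (Real.exp_pos _).ne', mul_add, hlogV,
      Real.log_mul hwθ.ne' (Real.exp_pos _).ne', Real.log_exp, Real.log_exp,
      Real.log_div hn'.ne' (by positivity), one_div (w θ), Real.log_inv]
    congr 1
    field_simp
    ring

/-- A bound up to every `ε > 0` is a bound up to a null sequence. -/
theorem exists_tendsto_zero_of_forall_eventually_le {D : ℕ → EReal} {c : ℕ → ℝ}
    (h : ∀ ε : ℝ, 0 < ε → ∀ᶠ n in atTop, D n ≤ ((c n + ε : ℝ) : EReal)) :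
    ∃ r : ℕ → ℝ, Tendsto r atTop (𝓝 0) ∧ ∀ᶠ n in atTop, D n ≤ ((c n + r n : ℝ) : EReal) := by
  -- The remainder is the positive part of the excess. The value `⊥` is separated because
  -- `EReal.toReal` sends it to `0`, which could leave a spurious excess `-c n`.
  refine ⟨fun n => if D n = ⊥ then 0 else max 0 ((D n).toReal - c n), ?_, ?_⟩
  · rw [Metric.tendsto_nhds]
    intro ε hε
    filter_upwards [h (ε / 2) (by positivity)] with n hn
    split_ifs with hb
    · simpa using hε
    · have ht : D n ≠ ⊤ := ne_top_of_le_ne_top (EReal.coe_ne_top _) hn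
      rw [← EReal.coe_toReal ht hb, EReal.coe_le_coe_iff] at hn
      rw [Real.dist_0_eq_abs, abs_of_nonneg (le_max_left _ _)]
      exact max_lt hε (by linarith)
  · filter_upwards [h 1 one_pos] with n hn
    split_ifs with hb
    · rw [hb]
      exact bot_le
    · have ht : D n ≠ ⊤ := ne_top_of_le_ne_top (EReal.coe_ne_top _) hn
      rw [← EReal.coe_toReal ht hb, EReal.coe_le_coe_iff, EReal.toReal_coe]
      linarith [le_max_right 0 ((D n).toReal - c n)]

end Redundancy

/-! ### The three bounds combined. -/

theorem mainTheorem4 {k : ℕ} {Y : Type*} [MeasurableSpace Y] (μ : Measure Y) [SigmaFinite μ]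
    (p₀ : Y → ℝ≥0) (g : Fin k → Y → ℝ) (φ : EuclideanSpace ℝ (Fin k) → ℝ)
    (Θ : Set (EuclideanSpace ℝ (Fin k))) (hfam : IsExponentialFamily μ p₀ g φ Θ)
    (w : EuclideanSpace ℝ (Fin k) → ℝ) (hw : IsPriorDensity Θ w) (hcont : ContinuousOn w Θ) :
    -- order `1 + n`, fixed parameter
    (∀ θ ∈ interior Θ, 0 < w θ → ∃ C : ℝ, ∀ᶠ n : ℕ in atTop,
      renyiRedundancy μ p₀ g φ Θ w (n : ℝ) n θ
        ≤ (((k : ℝ) / 2 * Real.log n + C : ℝ) : EReal)) ∧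
    -- order `1 + n`, uniformly on compact sets of parameters
    (∀ K : Set (EuclideanSpace ℝ (Fin k)), IsCompact K → K ⊆ interior Θ → (∀ θ ∈ K, 0 < w θ) →
      ∃ C : ℝ, ∀ᶠ n : ℕ in atTop, ∀ θ ∈ K,
        renyiRedundancy μ p₀ g φ Θ w (n : ℝ) n θ
          ≤ (((k : ℝ) / 2 * Real.log n + C : ℝ) : EReal)) ∧
    -- fixed order `1 + s`
    (∀ θ ∈ interior Θ, 0 < w θ → (fisherInfo φ θ).det ≠ 0 → ∀ s : ℝ, 0 < s →
      ∃ r : ℕ → ℝ, Tendsto r atTop (𝓝 0) ∧ ∀ᶠ n : ℕ in atTop,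
        renyiRedundancy μ p₀ g φ Θ w s n θ
          ≤ (((k : ℝ) / 2 * Real.log ((n : ℝ) / (2 * Real.pi))
              + 1 / 2 * Real.log (fisherInfo φ θ).det + Real.log (1 / w θ)
              - (k : ℝ) / (2 * s) * Real.log (1 + s) + r n : ℝ) : EReal)) := by
  have huniform : ∀ K : Set (EuclideanSpace ℝ (Fin k)), IsCompact K → K ⊆ interior Θ →
      (∀ θ ∈ K, 0 < w θ) → ∃ C : ℝ, ∀ᶠ n : ℕ in atTop, ∀ θ ∈ K,
        renyiRedundancy μ p₀ g φ Θ w (n : ℝ) n θ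
          ≤ (((k : ℝ) / 2 * Real.log n + C : ℝ) : EReal) := by
    intro K hK hKΘ hKw
    obtain ⟨C, hC⟩ := hfam.exists_forall_renyiRedundancy_le hcont hK hKΘ hKw
    refine ⟨C, ?_⟩
    filter_upwards [eventually_gt_atTop 0] with n hn θ hθ
    exact hC n hn n (by exact_mod_cast hn) θ hθ
  refine ⟨fun θ hθ hwθ => ?_, huniform, fun θ hθ hwθ hJ s hs => ?_⟩
  -- The pointwise bound is the uniform one on a singleton.
  · obtain ⟨C, hC⟩ := huniform {θ} isCompact_singleton (by simpa using hθ) (by simpa using hwθ)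
    exact ⟨C, hC.mono fun n hn => hn θ rfl⟩
  · exact exists_tendsto_zero_of_forall_eventually_le fun ε hε =>
      hfam.eventually_renyiRedundancy_le hcont hθ hwθ hJ hs hε
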